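/- **Setting.** Let $X\subseteq\mathbb R^d$, $Y\subseteq\mathbb R^n$ be closed convex sets and $f:X\times Y\to\mathbb R$ continuous, $\mu$-strongly convex in $x\in X$ for every $y\in Y$ and $\lambda$-strongly concave in $y\in Y$ for every $x\in X$ ($\mu,\lambda>0$; no smoothness is assumed). Put $m=\min\{\mu,\lambda\}$ and $\mathrm{Gap}(x,y)=\max_{y'\in Y}f(x,y')-\min_{x'\in X}f(x',y)$. Let $x_0\in X$, $y_0\in Y$, $\epsilon_0>0$ with $\mathrm{Gap}(x_0,y_0)\le\epsilon_0$. Let $\mathcal G_x(x,y;\xi)$, $\mathcal G_y(x,y;\xi)$ be stochastic subgradients: for all $(x,y)\in X\times Y$, $\mathbb E_\xi[\mathcal G_x(x,y;\xi)]$ is a subgradient of $f(\cdot,y)$ on $X$ at $x$, $\mathbb E_\xi[\mathcal G_y(x,y;\xi)]$ is a supergradient of $f(x,\cdot)$ on $Y$ at $y$, and, with constants $B_1,B_2>0$, $\mathbb E_\xi[\exp(\|\mathcal G_x(x,y;\xi)\|^2/B_1^2)]\le e$ and $\mathbb E_\xi[\exp(\|\mathcal G_y(x,y;\xi)\|^2/B_2^2)]\le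 e$. **Algorithm (Epoch-GDA).** Start from $x_0^1=x_0$, $y_0^1=y_0$ and parameters $\eta_x^1,\eta_y^1,R_1,T_1$. In epoch $k=1,\dots,K$, for $t=0,\dots,T_k-1$, with $\Pi_C$ the Euclidean projection onto $C$, $\mathcal B(c,R)$ the closed Euclidean ball, and independent samples $\xi_t^k$ with the law of $\xi$, $$x_{t+1}^k=\Pi_{X\cap\mathcal B(x_0^k,R_k)}\bigl(x_t^k-\eta_x^k\,\mathcal G_x(x_t^k,y_t^k;\xi_t^k)\bigr),\qquad y_{t+1}^k=\Pi_{Y\cap\mathcal B(y_0^k,R_k)}\bigl(y_t^k+\eta_y^k\,\mathcal G_y(x_t^k,y_t^k;\xi_t^k)\bigr).$$ Then $x_0^{k+1}=\bar x_k=\frac1{T_k}\sum_{t=0}^{T_k-1}x_t^k$, $y_0^{k+1}=\bar y_k=\frac1{T_k}\sum_{t=0}^{T_k-1}y_t^k$, and $\eta_x^{k+1}=\eta_x^k/2$, $\eta_y^{k+1}=\eta_y^k/2$, $R_{k+1}=R_k/\sqrt2$, $T_{k+1}=2T_k$. **Theorem.** Let $\delta\in(0,1)$, $\epsilon\in(0,1)$,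 $\epsilon<\epsilon_0$, $K=\lceil\log_2(\epsilon_0/\epsilon)\rceil$, $\tilde\delta=\delta/K$ and $$N=\max\bigl\{320^2(B_1+B_2)^2\cdot3\log(1/\tilde\delta),\ 3200\,(5+3\log(1/\tilde\delta))\max\{B_1^2,B_2^2\}\bigr\}.$$ Let $$R_1\ge 2\sqrt{2\epsilon_0/m},\qquad \eta_x^1=\frac{mR_1^2}{40(5+3\log(1/\tilde\delta))B_1^2},\qquad \eta_y^1=\frac{mR_1^2}{40(5+3\log(1/\tilde\delta))B_2^2},$$ and let $T_1$ be an integer with $T_1\ge N/(m^2R_1^2)$. Then: 1. With probability at least $1-\delta$, $\mathrm{Gap}(\bar x_K,\bar y_K)\le\frac{mR_1^2}{8\epsilon_0}\,\epsilon$. In particular, if $R_1=2\sqrt{2\epsilon_0/m}$, then with probability at least $1-\delta$, $\mathrm{Gap}(\bar x_K,\bar y_K)\le\epsilon$. 2. The total number of iterations $T_{tot}=\sum_{k=1}^KT_k$ satisfies $$T_{tot}\le\frac{N}{4m\epsilon}+\Bigl(T_1-\frac{N}{m^2R_1^2}\Bigr)\frac{2\epsilon_0}{\epsilon}.$$ In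 particular $T_{tot}\le\frac{N}{4m\epsilon}$ if $T_1=N/(m^2R_1^2)$, and $T_{tot}\le\frac{N}{4m\epsilon}+\frac{2\epsilon_0}{\epsilon}$ if $T_1=\lceil N/(m^2R_1^2)\rceil$. If $T_1=\lceil N/(m^2R_1^2)\rceil$ and $\epsilon_0\le(B_1+B_2)^2/m$, then $$T_{tot}\le 10^5\,\bigl(1+\log(K/\delta)\bigr)\frac{(B_1+B_2)^2}{m\,\epsilon}.$$ -/

import Mathlib

open MeasureTheory ProbabilityTheory

noncomputable section

/-- A minimizer of `g` over `S` (the minimizer, when it is unique). -/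
def argminOn {E : Type*} [Nonempty E] (g : E → ℝ) (S : Set E) : E :=
  Classical.epsilon fun a => a ∈ S ∧ IsMinOn g S a

/-- A maximizer of `g` over `S` (the maximizer, when it is unique). -/
def argmaxOn {E : Type*} [Nonempty E] (g : E → ℝ) (S : Set E) : E :=
  Classical.epsilon fun a => a ∈ S ∧ IsMaxOn g S a

/-- Euclidean projection onto `C`: the point of `C` closest to `z`
(it exists and is unique when `C` is nonempty, closed and convex). -/
def euclProj {d : ℕ} (C : Set (EuclideanSpace ℝ (Fin d))) (z : EuclideanSpace ℝ (Fin d)) :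
    EuclideanSpace ℝ (Fin d) :=
  argminOn (fun p => ‖p - z‖) C

/-- Duality gap `f (x, ŷ(x)) - f (x̂(y), y)`, where `ŷ(x)` maximizes `f (x, ·)` over `Y` and
`x̂(y)` minimizes `f (·, y)` over `X`. For `x ∈ X`, `y ∈ Y` both exist and are unique as soon as
`X`, `Y` are closed and `f` is continuous, strongly convex in `x` and strongly concave in `y`. -/
def dualityGap {d n : ℕ} (X : Set (EuclideanSpace ℝ (Fin d))) (Y : Set (EuclideanSpace ℝ (Fin n)))
    (f : EuclideanSpace ℝ (Fin d) → EuclideanSpace ℝ (Fin n) → ℝ)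
    (x : EuclideanSpace ℝ (Fin d)) (y : EuclideanSpace ℝ (Fin n)) : ℝ :=
  f x (argmaxOn (fun y' => f x y') Y) - f (argminOn (fun x' => f x' y) X) y

/-- `v` is a subgradient at `x` of the convex function `g` with domain `S`. -/
def IsSubgradientOn {d : ℕ} (S : Set (EuclideanSpace ℝ (Fin d)))
    (g : EuclideanSpace ℝ (Fin d) → ℝ) (x v : EuclideanSpace ℝ (Fin d)) : Prop :=
  ∀ z ∈ S, g x + inner ℝ v (z - x) ≤ g z

/-- `v` is a supergradient at `x` of the concave function `g` with domain `S`. -/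
def IsSupergradientOn {d : ℕ} (S : Set (EuclideanSpace ℝ (Fin d)))
    (g : EuclideanSpace ℝ (Fin d) → ℝ) (x v : EuclideanSpace ℝ (Fin d)) : Prop :=
  ∀ z ∈ S, g z ≤ g x + inner ℝ v (z - x)

/-- `E[exp (‖V‖² / B²)] ≤ exp 1` for a random vector `V` under the law `ν` (the expectation is a
Lebesgue integral in `[0, ∞]`, so it is in particular asserted to be finite). -/
def SubGaussianNorm {Ξ : Type*} [MeasurableSpace Ξ] {d : ℕ} (ν : Measure Ξ)
    (V : Ξ → EuclideanSpace ℝ (Fin d)) (B : ℝ) : Prop :=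
  ∫⁻ s, ENNReal.ofReal (Real.exp (‖V s‖ ^ 2 / B ^ 2)) ∂ν ≤ ENNReal.ofReal (Real.exp 1)

/-- The parameters of one epoch: step sizes, radius, number of iterations. -/
structure EpochParams where
  ηx : ℝ
  ηy : ℝ
  R : ℝ
  T : ℕ

/-- The parameters of the following epoch. -/
def EpochParams.next (p : EpochParams) : EpochParams where
  ηx := p.ηx / 2
  ηy := p.ηy / 2
  R := p.R / Real.sqrt 2
  T := 2 * p.T

/-- The parameters of epoch `k + 1` (epochs are numbered `1, 2, …`), from those of epoch `1`. -/
def epochParams (p : EpochParams) : ℕ → EpochParams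
  | 0 => p
  | k + 1 => (epochParams p k).next

/-- The iterate `(x_t, y_t)` of one epoch started at `(x0, y0)`: projected stochastic gradient
descent in `x` and ascent in `y`, `s t` being the sample drawn at step `t`. -/
def innerIterate {Ξ : Type*} {d n : ℕ}
    (X : Set (EuclideanSpace ℝ (Fin d))) (Y : Set (EuclideanSpace ℝ (Fin n)))
    (Gx : EuclideanSpace ℝ (Fin d) → EuclideanSpace ℝ (Fin n) → Ξ → EuclideanSpace ℝ (Fin d))
    (Gy : EuclideanSpace ℝ (Fin d) → EuclideanSpace ℝ (Fin n) → Ξ → EuclideanSpace ℝ (Fin n))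
    (p : EpochParams) (x0 : EuclideanSpace ℝ (Fin d)) (y0 : EuclideanSpace ℝ (Fin n))
    (s : ℕ → Ξ) : ℕ → EuclideanSpace ℝ (Fin d) × EuclideanSpace ℝ (Fin n)
  | 0 => (x0, y0)
  | t + 1 =>
    let z := innerIterate X Y Gx Gy p x0 y0 s t
    (euclProj (X ∩ Metric.closedBall x0 p.R) (z.1 - p.ηx • Gx z.1 z.2 (s t)),
      euclProj (Y ∩ Metric.closedBall y0 p.R) (z.2 + p.ηy • Gy z.1 z.2 (s t)))

/-- The averages `(x̄, ȳ)` of the iterates `t = 0, …, T - 1` of one epoch. -/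
def epochAverage {Ξ : Type*} {d n : ℕ}
    (X : Set (EuclideanSpace ℝ (Fin d))) (Y : Set (EuclideanSpace ℝ (Fin n)))
    (Gx : EuclideanSpace ℝ (Fin d) → EuclideanSpace ℝ (Fin n) → Ξ → EuclideanSpace ℝ (Fin d))
    (Gy : EuclideanSpace ℝ (Fin d) → EuclideanSpace ℝ (Fin n) → Ξ → EuclideanSpace ℝ (Fin n))
    (p : EpochParams) (x0 : EuclideanSpace ℝ (Fin d)) (y0 : EuclideanSpace ℝ (Fin n))
    (s : ℕ → Ξ) : EuclideanSpace ℝ (Fin d) × EuclideanSpace ℝ (Fin n) :=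
  ((1 / (p.T : ℝ)) • ∑ t ∈ Finset.range p.T, (innerIterate X Y Gx Gy p x0 y0 s t).1,
    (1 / (p.T : ℝ)) • ∑ t ∈ Finset.range p.T, (innerIterate X Y Gx Gy p x0 y0 s t).2)

/-- Epoch-GDA. `epochGDA … k` is the output `(x̄_k, ȳ_k)` of the `k`-th epoch, which is also the
starting point of epoch `k + 1`; for `k = 0` it is the initial point. `s k t` is the sample drawn
at step `t` of epoch `k + 1`. -/
def epochGDA {Ξ : Type*} {d n : ℕ}
    (X : Set (EuclideanSpace ℝ (Fin d))) (Y : Set (EuclideanSpace ℝ (Fin n)))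
    (Gx : EuclideanSpace ℝ (Fin d) → EuclideanSpace ℝ (Fin n) → Ξ → EuclideanSpace ℝ (Fin d))
    (Gy : EuclideanSpace ℝ (Fin d) → EuclideanSpace ℝ (Fin n) → Ξ → EuclideanSpace ℝ (Fin n))
    (p : EpochParams) (x0 : EuclideanSpace ℝ (Fin d)) (y0 : EuclideanSpace ℝ (Fin n))
    (s : ℕ → ℕ → Ξ) : ℕ → EuclideanSpace ℝ (Fin d) × EuclideanSpace ℝ (Fin n)
  | 0 => (x0, y0)
  | k + 1 =>
    let z := epochGDA X Y Gx Gy p x0 y0 s k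
    epochAverage X Y Gx Gy (epochParams p k) z.1 z.2 (s k)

/-- Total number of iterations performed in the first `K` epochs. -/
def totalIterations (p : EpochParams) (K : ℕ) : ℕ :=
  ∑ k ∈ Finset.range K, (epochParams p k).T

/-- The numerator `max {320² (B₁ + B₂)² · 3 log (1/δ'), 3200 (5 + 3 log (1/δ')) max {B₁², B₂²}}`
of the epoch length. -/
def epochConst (B₁ B₂ δ' : ℝ) : ℝ :=
  max (320 ^ 2 * (B₁ + B₂) ^ 2 * (3 * Real.log (1 / δ')))
    (3200 * (5 + 3 * Real.log (1 / δ')) * max (B₁ ^ 2) (B₂ ^ 2))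

end

/-! ### Projections onto `X ∩ B(c, R)` and the regret of projected descent -/

section EuclideanProjection

variable {d : ℕ}

/-! The invariant is that epoch `k + 1` starts with duality gap at most `m * R ^ 2 / 8`, for its own
radius `R`. If each epoch halves this bound with failure probability at most `δ / K`, a union bound
gives the accuracy claim, since `R ^ 2` is halved as well. The iteration count is a geometric sum.

Halving in one epoch rests on strong convexity. Let `S` be the sum of the squared distances from the
centre of the epoch to the best responses against the averages, taken inside the balls, and let `G`
be the gap restricted to these responses. Comparing the best responses with the centre gives `m * S
/ 4 ≤ m * R ^ 2 / 8 + G`, while the regret analysis bounds `G` by a small multiple of `m * S` plus a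
small multiple of `m * R ^ 2`. Together these give `G ≤ m * R ^ 2 / 16` and `S < R ^ 2`. The best
responses are thus interior to the balls, hence global by convexity, and `G` is the true gap
(`dualityGap_le_of_forall_sub_le`).

The regret bound must hold for all comparators at once, because the best responses depend on the
noise. A second descent, driven by the errors of the stochastic directions, absorbs the comparator
(`sum_inner_projDescent_le_of_estimate`). What remains is a sum of squared norms and a martingale
independent of the comparator.

Both remainders are controlled by a single e-value. Convex combinations of log-e-values are
log-e-values, so each step has one exponent mixing its squared norms with its martingale increment
(`isLogEValue_stepExponent`). Fresh samples allow the exponents to be added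
(`isLogEValue_sum_of_indep`), and Markov's inequality gives failure probability `exp (-L)` with `L =
log (1 / δ')`. -/

theorem exists_isMinOn_norm_sub {C : Set (EuclideanSpace ℝ (Fin d))} (hne : C.Nonempty)
    (hC : IsClosed C) (z : EuclideanSpace ℝ (Fin d)) :
    ∃ a, a ∈ C ∧ IsMinOn (fun p => ‖p - z‖) C a := by
  obtain ⟨a, ha, h⟩ := hC.exists_infDist_eq_dist hne z
  refine ⟨a, ha, fun w hw => ?_⟩
  simp only [Set.mem_ofPred_eq, ← dist_eq_norm]
  rw [dist_comm a, dist_comm w, ← h]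
  exact Metric.infDist_le_dist_of_mem hw

theorem euclProj_mem {C : Set (EuclideanSpace ℝ (Fin d))} (hne : C.Nonempty)
    (hC : IsClosed C) (z : EuclideanSpace ℝ (Fin d)) : euclProj C z ∈ C :=
  (Classical.epsilon_spec (exists_isMinOn_norm_sub hne hC z)).1

theorem isMinOn_euclProj {C : Set (EuclideanSpace ℝ (Fin d))} (hne : C.Nonempty)
    (hC : IsClosed C) (z : EuclideanSpace ℝ (Fin d)) :
    IsMinOn (fun p => ‖p - z‖) C (euclProj C z) :=
  (Classical.epsilon_spec (exists_isMinOn_norm_sub hne hC z)).2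

theorem inner_sub_euclProj_le_zero {C : Set (EuclideanSpace ℝ (Fin d))}
    (hC : IsClosed C) (hconv : Convex ℝ C) (z : EuclideanSpace ℝ (Fin d))
    {w : EuclideanSpace ℝ (Fin d)} (hw : w ∈ C) :
    inner ℝ (z - euclProj C z) (w - euclProj C z) ≤ 0 := by
  have hne : C.Nonempty := ⟨w, hw⟩
  have hmem := euclProj_mem hne hC z
  refine (norm_eq_iInf_iff_real_inner_le_zero hconv hmem).1 ?_ w hw
  have : Nonempty C := hne.to_subtype
  refine le_antisymm (le_ciInf fun q => ?_) (ciInf_le (f := fun q : C => ‖z - q‖) ⟨0, ?_⟩ ⟨_, hmem⟩)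
  · have := isMinOn_euclProj hne hC z q.2
    simp only [Set.mem_ofPred_eq] at this
    rwa [norm_sub_rev z, norm_sub_rev z]
  · rintro _ ⟨q, rfl⟩
    exact norm_nonneg _

theorem norm_euclProj_sub_sq_le {C : Set (EuclideanSpace ℝ (Fin d))}
    (hC : IsClosed C) (hconv : Convex ℝ C) (z : EuclideanSpace ℝ (Fin d))
    {w : EuclideanSpace ℝ (Fin d)} (hw : w ∈ C) :
    ‖euclProj C z - w‖ ^ 2 ≤ ‖z - w‖ ^ 2 := by
  have h := inner_sub_euclProj_le_zero hC hconv z hw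
  have e : z - w = (z - euclProj C z) - (w - euclProj C z) := by abel
  rw [e, norm_sub_sq_real (z - euclProj C z), norm_sub_rev (euclProj C z) w]
  nlinarith [sq_nonneg ‖z - euclProj C z‖]

/-- A point of `X ∩ B(c, R)` has a neighbour at distance at most `‖c - c'‖` in `X ∩ B(c', R)`. -/
theorem exists_mem_inter_closedBall_near {X : Set (EuclideanSpace ℝ (Fin d))}
    (hconv : Convex ℝ X) {R : ℝ} (hR : 0 < R) {c c' q : EuclideanSpace ℝ (Fin d)}
    (hc' : c' ∈ X) (hq : q ∈ X ∩ Metric.closedBall c R) :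
    ∃ w ∈ X ∩ Metric.closedBall c' R, ‖w - q‖ ≤ ‖c - c'‖ := by
  have hpos : 0 < R + ‖c - c'‖ := by positivity
  have hqc : ‖q - c'‖ ≤ R + ‖c - c'‖ := by
    have h1 : ‖q - c‖ ≤ R := by simpa [dist_eq_norm] using hq.2
    calc ‖q - c'‖ = ‖(q - c) + (c - c')‖ := by congr 1; abel
      _ ≤ ‖q - c‖ + ‖c - c'‖ := norm_add_le _ _
      _ ≤ _ := by linarith
  -- Contracting towards `c'` by this ratio brings the ball of radius `R + ‖c - c'‖`, which contains
  -- `q`, back to radius `R`.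
  set θ := R / (R + ‖c - c'‖) with hθ
  have hθ0 : 0 ≤ θ := by positivity
  have hθ1 : 1 - θ = ‖c - c'‖ / (R + ‖c - c'‖) := by rw [hθ]; field_simp; ring
  have hθ1' : 0 ≤ 1 - θ := by rw [hθ1]; positivity
  refine ⟨(1 - θ) • c' + θ • q, ⟨hconv hc' hq.1 hθ1' hθ0 (by ring), ?_⟩, ?_⟩
  · have : (1 - θ) • c' + θ • q - c' = θ • (q - c') := by module
    rw [mem_closedBall_iff_norm, this, norm_smul, Real.norm_of_nonneg hθ0]
    calc θ * ‖q - c'‖ ≤ θ * (R + ‖c - c'‖) := by gcongr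
      _ = R := by rw [hθ]; field_simp
  · have : (1 - θ) • c' + θ • q - q = (1 - θ) • (c' - q) := by module
    rw [this, norm_smul, Real.norm_of_nonneg hθ1', norm_sub_rev]
    calc (1 - θ) * ‖q - c'‖ ≤ (1 - θ) * (R + ‖c - c'‖) := by gcongr
      _ = ‖c - c'‖ := by rw [hθ1]; field_simp

theorem norm_sub_euclProj_le {C : Set (EuclideanSpace ℝ (Fin d))}
    (hC : IsClosed C) (z : EuclideanSpace ℝ (Fin d)) {c : EuclideanSpace ℝ (Fin d)} (hc : c ∈ C) :
    ‖z - euclProj C z‖ ≤ ‖z - c‖ := by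
  have := isMinOn_euclProj ⟨c, hc⟩ hC z hc
  simp only [Set.mem_ofPred_eq] at this
  rwa [norm_sub_rev z, norm_sub_rev z]

/-- Each projection satisfies a variational inequality only against points of its own set. Testing
it at the neighbour of the other projection costs at most `‖c - c'‖` times the distance to the set.
-/
theorem norm_euclProj_inter_closedBall_sub_sq_le {X : Set (EuclideanSpace ℝ (Fin d))}
    (hX : IsClosed X) (hconv : Convex ℝ X) {R : ℝ} (hR : 0 < R)
    {c c' : EuclideanSpace ℝ (Fin d)} (hc : c ∈ X) (hc' : c' ∈ X)
    (z z' : EuclideanSpace ℝ (Fin d)) :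
    ‖euclProj (X ∩ Metric.closedBall c R) z - euclProj (X ∩ Metric.closedBall c' R) z'‖ ^ 2 ≤
      ‖z - z'‖ ^ 2 + 2 * ‖c - c'‖ * (‖z - c‖ + ‖z' - c'‖) := by
  have hcC : c ∈ X ∩ Metric.closedBall c R := ⟨hc, Metric.mem_closedBall_self hR.le⟩
  have hcC' : c' ∈ X ∩ Metric.closedBall c' R := ⟨hc', Metric.mem_closedBall_self hR.le⟩
  have hcl : IsClosed (X ∩ Metric.closedBall c R) := hX.inter Metric.isClosed_closedBall
  have hcl' : IsClosed (X ∩ Metric.closedBall c' R) := hX.inter Metric.isClosed_closedBall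
  have hcv : Convex ℝ (X ∩ Metric.closedBall c R) := hconv.inter (convex_closedBall c R)
  have hcv' : Convex ℝ (X ∩ Metric.closedBall c' R) := hconv.inter (convex_closedBall c' R)
  set q := euclProj (X ∩ Metric.closedBall c R) z
  set q' := euclProj (X ∩ Metric.closedBall c' R) z'
  obtain ⟨w', hw', hwq'⟩ := exists_mem_inter_closedBall_near hconv hR hc'
    (euclProj_mem ⟨c, hcC⟩ hcl z)
  obtain ⟨w, hw, hwq⟩ := exists_mem_inter_closedBall_near hconv hR hc
    (euclProj_mem ⟨c', hcC'⟩ hcl' z')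
  have i1 : inner ℝ (z - q) (w - q) ≤ 0 := inner_sub_euclProj_le_zero hcl hcv z hw
  have i2 : inner ℝ (z' - q') (w' - q') ≤ 0 := inner_sub_euclProj_le_zero hcl' hcv' z' hw'
  have n1 : ‖z - q‖ ≤ ‖z - c‖ := norm_sub_euclProj_le hcl z hcC
  have n2 : ‖z' - q'‖ ≤ ‖z' - c'‖ := norm_sub_euclProj_le hcl' z' hcC'
  have b1 : inner ℝ (z - q) (q' - w) ≤ ‖z - c‖ * ‖c - c'‖ := by
    refine (real_inner_le_norm _ _).trans ?_
    rw [norm_sub_rev q' w, norm_sub_rev c c']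
    gcongr
  have b2 : inner ℝ (z' - q') (q - w') ≤ ‖z' - c'‖ * ‖c - c'‖ := by
    refine (real_inner_le_norm _ _).trans ?_
    rw [norm_sub_rev q w']
    gcongr
  have key : inner ℝ (z - q) (w - q) + inner ℝ (z - q) (q' - w)
      + (inner ℝ (z' - q') (w' - q') + inner ℝ (z' - q') (q - w'))
      = ‖q - q'‖ ^ 2 - inner ℝ (z - z') (q - q') := by
    rw [← inner_add_right, ← inner_add_right, ← real_inner_self_eq_norm_sq]
    have e1 : w - q + (q' - w) = -(q - q') := by abel
    have e2 : w' - q' + (q - w') = q - q' := by abel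
    rw [e1, e2, inner_neg_right, ← sub_eq_zero]
    simp only [inner_sub_left]
    ring
  have hin : inner ℝ (z - z') (q - q') ≤ ‖z - z'‖ ^ 2 / 2 + ‖q - q'‖ ^ 2 / 2 := by
    have := real_inner_le_norm (z - z') (q - q')
    nlinarith [sq_nonneg (‖z - z'‖ - ‖q - q'‖)]
  nlinarith

/-- The projection onto `X ∩ B(c, R)` is jointly continuous in the centre and the point. -/
theorem continuous_euclProj_inter_closedBall {X : Set (EuclideanSpace ℝ (Fin d))}
    (hX : IsClosed X) (hconv : Convex ℝ X) {R : ℝ} (hR : 0 < R) :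
    Continuous fun u : X × EuclideanSpace ℝ (Fin d) =>
      euclProj (X ∩ Metric.closedBall (u.1 : EuclideanSpace ℝ (Fin d)) R) u.2 := by
  refine continuous_iff_continuousAt.2 fun u => ?_
  rw [ContinuousAt, tendsto_iff_norm_sub_tendsto_zero]
  have hsq : Filter.Tendsto (fun v : X × EuclideanSpace ℝ (Fin d) =>
      √(‖v.2 - u.2‖ ^ 2 + 2 * ‖(v.1 : EuclideanSpace ℝ (Fin d)) - u.1‖
        * (‖v.2 - v.1‖ + ‖u.2 - u.1‖))) (nhds u) (nhds 0) := by
    have : Continuous (fun v : X × EuclideanSpace ℝ (Fin d) =>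
      √(‖v.2 - u.2‖ ^ 2 + 2 * ‖(v.1 : EuclideanSpace ℝ (Fin d)) - u.1‖
        * (‖v.2 - v.1‖ + ‖u.2 - u.1‖))) := by fun_prop
    simpa using this.tendsto u
  refine squeeze_zero (fun _ => norm_nonneg _) (fun v => ?_) hsq
  exact Real.le_sqrt_of_sq_le
    (norm_euclProj_inter_closedBall_sub_sq_le hX hconv hR v.1.2 u.1.2 v.2 u.2)

/-- From the second epoch on the centre of the ball is random, so measurability in the projected
point alone would not suffice. -/
theorem measurable_euclProj_inter_closedBall {α : Type*} {mα : MeasurableSpace α}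
    {X : Set (EuclideanSpace ℝ (Fin d))}
    (hX : IsClosed X) (hconv : Convex ℝ X) {R : ℝ} (hR : 0 < R)
    {c z : α → EuclideanSpace ℝ (Fin d)} (hc : Measurable c) (hcX : ∀ a, c a ∈ X)
    (hz : Measurable z) :
    Measurable fun a => euclProj (X ∩ Metric.closedBall (c a) R) (z a) := by
  have := (continuous_euclProj_inter_closedBall hX hconv hR).measurable.comp
    ((hc.subtype_mk (h := hcX)).prodMk hz)
  exact this

/-- Projected descent from `u₀` along the directions `g t`, with constant step size `η`. -/
noncomputable def projDescent (C : Set (EuclideanSpace ℝ (Fin d))) (η : ℝ)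
    (g : ℕ → EuclideanSpace ℝ (Fin d)) (u₀ : EuclideanSpace ℝ (Fin d)) :
    ℕ → EuclideanSpace ℝ (Fin d)
  | 0 => u₀
  | t + 1 => euclProj C (projDescent C η g u₀ t - η • g t)

theorem projDescent_mem {C : Set (EuclideanSpace ℝ (Fin d))} (hC : IsClosed C) {η : ℝ}
    {g : ℕ → EuclideanSpace ℝ (Fin d)} {u₀ : EuclideanSpace ℝ (Fin d)} (hu₀ : u₀ ∈ C) (t : ℕ) :
    projDescent C η g u₀ t ∈ C := by
  cases t with
  | zero => exact hu₀
  | succ t => exact euclProj_mem ⟨u₀, hu₀⟩ hC _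

theorem sum_inner_projDescent_le {C : Set (EuclideanSpace ℝ (Fin d))} (hC : IsClosed C)
    (hconv : Convex ℝ C) {η : ℝ} (hη : 0 < η)
    (g : ℕ → EuclideanSpace ℝ (Fin d)) (u₀ : EuclideanSpace ℝ (Fin d))
    {z : EuclideanSpace ℝ (Fin d)} (hz : z ∈ C) (T : ℕ) :
    ∑ t ∈ Finset.range T, inner ℝ (g t) (projDescent C η g u₀ t - z) ≤
      ‖z - u₀‖ ^ 2 / (2 * η) + η / 2 * ∑ t ∈ Finset.range T, ‖g t‖ ^ 2 := by
  -- Keeping the final distance on the left makes the induction telescope.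
  have key : ∀ T, ∑ t ∈ Finset.range T, inner ℝ (g t) (projDescent C η g u₀ t - z)
      + ‖projDescent C η g u₀ T - z‖ ^ 2 / (2 * η) ≤
      ‖z - u₀‖ ^ 2 / (2 * η) + η / 2 * ∑ t ∈ Finset.range T, ‖g t‖ ^ 2 := by
    intro T
    induction T with
    | zero => simp [projDescent, norm_sub_rev]
    | succ T ih =>
      rw [Finset.sum_range_succ, Finset.sum_range_succ]
      set u := projDescent C η g u₀ T
      have h : ‖projDescent C η g u₀ (T + 1) - z‖ ^ 2 ≤
          ‖u - z‖ ^ 2 - 2 * η * inner ℝ (g T) (u - z) + η ^ 2 * ‖g T‖ ^ 2 := by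
        refine (norm_euclProj_sub_sq_le hC hconv (u - η • g T) hz).trans_eq ?_
        have e : u - η • g T - z = (u - z) - η • g T := by abel
        rw [e, norm_sub_sq_real, inner_smul_right, norm_smul, Real.norm_of_nonneg hη.le,
          real_inner_comm]
        ring
      have h2 : ‖projDescent C η g u₀ (T + 1) - z‖ ^ 2 / (2 * η) ≤
          ‖u - z‖ ^ 2 / (2 * η) - inner ℝ (g T) (u - z) + η / 2 * ‖g T‖ ^ 2 := by
        have : ‖u - z‖ ^ 2 / (2 * η) - inner ℝ (g T) (u - z) + η / 2 * ‖g T‖ ^ 2 =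
          (‖u - z‖ ^ 2 - 2 * η * inner ℝ (g T) (u - z) + η ^ 2 * ‖g T‖ ^ 2) / (2 * η) := by
          field_simp
        rw [this]
        gcongr
      linarith
  have := key T
  have h0 : 0 ≤ ‖projDescent C η g u₀ T - z‖ ^ 2 / (2 * η) := by positivity
  linarith

/-- Regret bound with the exact directions `g' t` for projected descent along their estimates
`g t`; the auxiliary descent along the errors makes the bound uniform in the comparator `z`. -/
theorem sum_inner_projDescent_le_of_estimate {C : Set (EuclideanSpace ℝ (Fin d))}
    (hC : IsClosed C) (hconv : Convex ℝ C) {η B : ℝ} (hη : 0 < η)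
    (g g' : ℕ → EuclideanSpace ℝ (Fin d)) (hg' : ∀ t, ‖g' t‖ ≤ B)
    (u₀ : EuclideanSpace ℝ (Fin d)) {z : EuclideanSpace ℝ (Fin d)} (hz : z ∈ C) (T : ℕ) :
    ∑ t ∈ Finset.range T, inner ℝ (g' t) (projDescent C η g u₀ t - z) ≤
      3 / (2 * η) * ‖z - u₀‖ ^ 2 + η / 2 * ∑ t ∈ Finset.range T, (2 * ‖g t‖ ^ 2 + B ^ 2)
      + ∑ t ∈ Finset.range T, inner ℝ (g' t - g t) (projDescent C η g u₀ t
          - projDescent C (η / 2) (fun t => g' t - g t) u₀ t) := by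
  have h1 := sum_inner_projDescent_le hC hconv hη g u₀ hz T
  have h2 := sum_inner_projDescent_le hC hconv (half_pos hη) (fun t => g' t - g t) u₀ hz T
  have e : ∀ t, inner ℝ (g' t) (projDescent C η g u₀ t - z) =
      inner ℝ (g t) (projDescent C η g u₀ t - z)
      + inner ℝ (g' t - g t) (projDescent C (η / 2) (fun t => g' t - g t) u₀ t - z)
      + inner ℝ (g' t - g t) (projDescent C η g u₀ t
          - projDescent C (η / 2) (fun t => g' t - g t) u₀ t) := by
    intro t
    rw [add_assoc, ← inner_add_right, ← sub_eq_iff_eq_add', ← inner_sub_left]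
    congr 1
    abel
  -- The errors are handled by `‖g' - g‖ ^ 2 / 2 ≤ ‖g‖ ^ 2 + B ^ 2`. The halved step of the
  -- auxiliary descent provides the factor `1 / 2`, at the price of the `3` in the distance term.
  have h3 : η / 2 * ∑ t ∈ Finset.range T, ‖g t‖ ^ 2
      + η / 2 / 2 * ∑ t ∈ Finset.range T, ‖g' t - g t‖ ^ 2 ≤
      η / 2 * ∑ t ∈ Finset.range T, (2 * ‖g t‖ ^ 2 + B ^ 2) := by
    have : ∑ t ∈ Finset.range T, ‖g t‖ ^ 2 + 1 / 2 * ∑ t ∈ Finset.range T, ‖g' t - g t‖ ^ 2 ≤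
        ∑ t ∈ Finset.range T, (2 * ‖g t‖ ^ 2 + B ^ 2) := by
      rw [Finset.mul_sum, ← Finset.sum_add_distrib]
      refine Finset.sum_le_sum fun t _ => ?_
      have n1 : ‖g' t - g t‖ ≤ ‖g' t‖ + ‖g t‖ := norm_sub_le _ _
      have n2 := hg' t
      have : ‖g' t - g t‖ ^ 2 ≤ (B + ‖g t‖) ^ 2 := by gcongr; linarith
      nlinarith [sq_nonneg (B - ‖g t‖)]
    nlinarith
  simp only [e, Finset.sum_add_distrib] at *
  have e2 : 3 / (2 * η) * ‖z - u₀‖ ^ 2 =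
      ‖z - u₀‖ ^ 2 / (2 * η) + ‖z - u₀‖ ^ 2 / (2 * (η / 2)) := by field_simp; ring
  linarith

end EuclideanProjection

/-! ### Strong convexity: quadratic growth and existence of minimizers -/

section StrongConvexity

variable {d : ℕ}

theorem StrongConvexOn.convexOn_of_pos {S : Set (EuclideanSpace ℝ (Fin d))}
    {g : EuclideanSpace ℝ (Fin d) → ℝ} {μ : ℝ} (hμ : 0 < μ) (hg : StrongConvexOn S μ g) :
    ConvexOn ℝ S g :=
  UniformConvexOn.convexOn hg fun r => by simp only [Pi.zero_apply]; positivity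

theorem StrongConvexOn.map_midpoint_le {S : Set (EuclideanSpace ℝ (Fin d))}
    {g : EuclideanSpace ℝ (Fin d) → ℝ} {μ : ℝ} (hg : StrongConvexOn S μ g)
    {x z : EuclideanSpace ℝ (Fin d)} (hx : x ∈ S) (hz : z ∈ S) :
    g ((1 / 2 : ℝ) • x + (1 / 2 : ℝ) • z) ≤ (g x + g z) / 2 - μ / 8 * ‖x - z‖ ^ 2 := by
  obtain ⟨-, h⟩ := hg
  have := h hx hz (a := 1 / 2) (b := 1 / 2) (by norm_num) (by norm_num) (by norm_num)
  simp only [smul_eq_mul] at this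
  linarith

/-- Comparing the minimizer with a midpoint gives `μ / 4` instead of the sharp `μ / 2`; the slack in
the later constants allows this. -/
theorem StrongConvexOn.norm_sub_sq_le_of_isMinOn {S C : Set (EuclideanSpace ℝ (Fin d))}
    {g : EuclideanSpace ℝ (Fin d) → ℝ} {μ : ℝ} (hg : StrongConvexOn S μ g) (hCS : C ⊆ S)
    (hC : Convex ℝ C) {x z : EuclideanSpace ℝ (Fin d)} (hx : x ∈ C) (hmin : IsMinOn g C x)
    (hz : z ∈ C) : μ / 4 * ‖x - z‖ ^ 2 ≤ g z - g x := by
  have h1 := hg.map_midpoint_le (hCS hx) (hCS hz)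
  have h2 := hmin (hC hx hz (a := 1 / 2) (b := 1 / 2) (by norm_num) (by norm_num) (by norm_num))
  simp only [Set.mem_ofPred_eq] at h2
  linarith

/-- A single subgradient makes `g` coercive: its value at the midpoint of `x` and `z`, bounded above
by strong convexity and below by the subgradient, forces `g x ≤ g z` once `‖z - x‖ ≥ 4 * ‖v‖ / μ`.
Existence is needed for `argminOn` in the gap to be meaningful. -/
theorem StrongConvexOn.exists_isMinOn {S : Set (EuclideanSpace ℝ (Fin d))}
    {g : EuclideanSpace ℝ (Fin d) → ℝ} {μ : ℝ} (hμ : 0 < μ) (hg : StrongConvexOn S μ g)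
    (hS : IsClosed S) (hcont : ContinuousOn g S) {x v : EuclideanSpace ℝ (Fin d)} (hx : x ∈ S)
    (hv : IsSubgradientOn S g x v) : ∃ a, a ∈ S ∧ IsMinOn g S a := by
  have hr : 0 ≤ 4 * ‖v‖ / μ := by positivity
  have hK : IsCompact (S ∩ Metric.closedBall x (4 * ‖v‖ / μ)) :=
    (isCompact_closedBall x _).inter_left hS
  obtain ⟨a, ha, hmin⟩ := hK.exists_isMinOn ⟨x, hx, Metric.mem_closedBall_self hr⟩
    (hcont.mono Set.inter_subset_left)
  refine ⟨a, ha.1, fun z hz => ?_⟩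
  by_cases hzb : z ∈ Metric.closedBall x (4 * ‖v‖ / μ)
  · exact hmin ⟨hz, hzb⟩
  · have hax : g a ≤ g x := hmin ⟨hx, Metric.mem_closedBall_self hr⟩
    have h1 := hg.map_midpoint_le hx hz
    have hconv : Convex ℝ S := (hg.convexOn_of_pos hμ).1
    have h2 := hv _ (hconv hx hz (a := 1 / 2) (b := 1 / 2) (by norm_num) (by norm_num) (by norm_num))
    have e : (1 / 2 : ℝ) • x + (1 / 2 : ℝ) • z - x = (1 / 2 : ℝ) • (z - x) := by module
    rw [e, inner_smul_right] at h2
    have h3 : -(‖v‖ * ‖z - x‖) ≤ inner ℝ v (z - x) := by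
      have := abs_real_inner_le_norm v (z - x)
      exact (abs_le.1 this).1
    have h4 : 4 * ‖v‖ ≤ μ * ‖z - x‖ := by
      rw [mem_closedBall_iff_norm, not_le, div_lt_iff₀ hμ] at hzb
      linarith
    rw [norm_sub_rev x z] at h1
    show g a ≤ g z
    nlinarith [norm_nonneg (z - x)]

theorem argminOn_spec {E : Type*} [Nonempty E] {g : E → ℝ} {S : Set E}
    (h : ∃ a, a ∈ S ∧ IsMinOn g S a) : argminOn g S ∈ S ∧ IsMinOn g S (argminOn g S) :=
  Classical.epsilon_spec h

theorem argmaxOn_spec {E : Type*} [Nonempty E] {g : E → ℝ} {S : Set E}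
    (h : ∃ a, a ∈ S ∧ IsMaxOn g S a) : argmaxOn g S ∈ S ∧ IsMaxOn g S (argmaxOn g S) :=
  Classical.epsilon_spec h

theorem ConvexOn.isMinOn_of_norm_sub_lt {S : Set (EuclideanSpace ℝ (Fin d))}
    {g : EuclideanSpace ℝ (Fin d) → ℝ} (hg : ConvexOn ℝ S g)
    {x c : EuclideanSpace ℝ (Fin d)} {R : ℝ} (hx : x ∈ S)
    (hmin : IsMinOn g (S ∩ Metric.closedBall c R) x) (hlt : ‖x - c‖ < R) : IsMinOn g S x := by
  refine IsMinOn.of_isLocalMinOn_of_convexOn hx ?_ hg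
  have hb : Metric.closedBall c R ∈ nhds x :=
    Filter.mem_of_superset (Metric.isOpen_ball.mem_nhds (mem_ball_iff_norm.2 hlt))
      Metric.ball_subset_closedBall
  rw [IsLocalMinOn, IsMinFilter]
  filter_upwards [self_mem_nhdsWithin, mem_nhdsWithin_of_mem_nhds hb] with z hz hzb
  exact hmin ⟨hz, hzb⟩

end StrongConvexity

/-! ### Duality gap: localization and averaging -/

section DualityGap

variable {d n : ℕ}

theorem StrongConcaveOn.strongConvexOn_neg {S : Set (EuclideanSpace ℝ (Fin d))}
    {g : EuclideanSpace ℝ (Fin d) → ℝ} {lam : ℝ} (hg : StrongConcaveOn S lam g) :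
    StrongConvexOn S lam (fun z => -g z) :=
  UniformConcaveOn.neg hg

theorem StrongConcaveOn.exists_isMaxOn {S : Set (EuclideanSpace ℝ (Fin d))}
    {g : EuclideanSpace ℝ (Fin d) → ℝ} {lam : ℝ} (hlam : 0 < lam) (hg : StrongConcaveOn S lam g)
    (hS : IsClosed S) (hcont : ContinuousOn g S) {x v : EuclideanSpace ℝ (Fin d)} (hx : x ∈ S)
    (hv : IsSupergradientOn S g x v) : ∃ a, a ∈ S ∧ IsMaxOn g S a := by
  obtain ⟨a, ha, hmin⟩ := hg.strongConvexOn_neg.exists_isMinOn hlam hS hcont.neg hx (v := -v)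
    (fun z hz => by have := hv z hz; rw [inner_neg_left]; linarith)
  refine ⟨a, ha, fun z hz => ?_⟩
  have : -g a ≤ -g z := hmin hz
  exact neg_le_neg_iff.1 this

theorem sub_le_dualityGap {X : Set (EuclideanSpace ℝ (Fin d))}
    {Y : Set (EuclideanSpace ℝ (Fin n))}
    {f : EuclideanSpace ℝ (Fin d) → EuclideanSpace ℝ (Fin n) → ℝ}
    {x x' : EuclideanSpace ℝ (Fin d)} {y y' : EuclideanSpace ℝ (Fin n)}
    (hmin : ∃ a, a ∈ X ∧ IsMinOn (fun x' => f x' y) X a)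
    (hmax : ∃ a, a ∈ Y ∧ IsMaxOn (fun y' => f x y') Y a) (hx' : x' ∈ X) (hy' : y' ∈ Y) :
    f x y' - f x' y ≤ dualityGap X Y f x y := by
  have h1 := (argminOn_spec hmin).2 hx'
  have h2 := (argmaxOn_spec hmax).2 hy'
  simp only [Set.mem_ofPred_eq] at h1 h2
  unfold dualityGap
  linarith

/-- If the gap restricted to balls around `(c₁, c₂)` obeys a regret bound at `(x, y)`, then the
restricted optimizers are interior to the balls, so that the full gap is small. -/
theorem dualityGap_le_of_forall_sub_le {X : Set (EuclideanSpace ℝ (Fin d))}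
    {Y : Set (EuclideanSpace ℝ (Fin n))}
    (hXclosed : IsClosed X) (hYclosed : IsClosed Y)
    {f : EuclideanSpace ℝ (Fin d) → EuclideanSpace ℝ (Fin n) → ℝ}
    (hf : ContinuousOn (fun p : EuclideanSpace ℝ (Fin d) × EuclideanSpace ℝ (Fin n) => f p.1 p.2)
      (X ×ˢ Y))
    {μ lam m : ℝ} (hm0 : 0 < m) (hmμ : m ≤ μ) (hmlam : m ≤ lam)
    (hfx : ∀ y ∈ Y, StrongConvexOn X μ (fun x => f x y))
    (hfy : ∀ x ∈ X, StrongConcaveOn Y lam (fun y => f x y))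
    (hmin : ∀ y ∈ Y, ∃ a, a ∈ X ∧ IsMinOn (fun x' => f x' y) X a)
    (hmax : ∀ x ∈ X, ∃ a, a ∈ Y ∧ IsMaxOn (fun y' => f x y') Y a)
    {c₁ : EuclideanSpace ℝ (Fin d)} {c₂ : EuclideanSpace ℝ (Fin n)} (hc₁ : c₁ ∈ X) (hc₂ : c₂ ∈ Y)
    {R : ℝ} (hR : 0 < R) (hgap : dualityGap X Y f c₁ c₂ ≤ m * R ^ 2 / 8)
    {x : EuclideanSpace ℝ (Fin d)} {y : EuclideanSpace ℝ (Fin n)} (hx : x ∈ X) (hy : y ∈ Y)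
    {e : ℝ} (he : e ≤ 37 / 800 * (m * R ^ 2))
    (hreg : ∀ x' ∈ X ∩ Metric.closedBall c₁ R, ∀ y' ∈ Y ∩ Metric.closedBall c₂ R,
      f x y' - f x' y ≤ 3 * m / 160 * (‖x' - c₁‖ ^ 2 + ‖y' - c₂‖ ^ 2) + e) :
    dualityGap X Y f x y ≤ m * R ^ 2 / 16 := by
  have hc₁B : c₁ ∈ X ∩ Metric.closedBall c₁ R := ⟨hc₁, Metric.mem_closedBall_self hR.le⟩
  have hc₂B : c₂ ∈ Y ∩ Metric.closedBall c₂ R := ⟨hc₂, Metric.mem_closedBall_self hR.le⟩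
  have hμ : 0 < μ := hm0.trans_le hmμ
  have hlam : 0 < lam := hm0.trans_le hmlam
  have hcx : ContinuousOn (fun x' => f x' y) X :=
    hf.comp (f := fun x' => (x', y)) (by fun_prop) fun x' hx' => ⟨hx', hy⟩
  have hcy : ContinuousOn (fun y' => f x y') Y :=
    hf.comp (f := fun y' => (x, y')) (by fun_prop) fun y' hy' => ⟨hx, hy'⟩
  have hsx := hfx y hy
  have hsy := (hfy x hx).strongConvexOn_neg
  have hXconv : Convex ℝ X := (hsx.convexOn_of_pos hμ).1
  have hYconv : Convex ℝ Y := (hsy.convexOn_of_pos hlam).1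
  obtain ⟨a, ha, hamin⟩ := ((isCompact_closedBall c₁ R).inter_left hXclosed).exists_isMinOn
    ⟨c₁, hc₁B⟩ (hcx.mono Set.inter_subset_left)
  obtain ⟨b, hb, hbmin⟩ := ((isCompact_closedBall c₂ R).inter_left hYclosed).exists_isMinOn
    ⟨c₂, hc₂B⟩ (hcy.neg.mono Set.inter_subset_left)
  have q1 : μ / 4 * ‖a - c₁‖ ^ 2 ≤ f c₁ y - f a y :=
    hsx.norm_sub_sq_le_of_isMinOn Set.inter_subset_left (hXconv.inter (convex_closedBall c₁ R))
      ha hamin hc₁B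
  have q2 : lam / 4 * ‖b - c₂‖ ^ 2 ≤ -f x c₂ - -f x b :=
    hsy.norm_sub_sq_le_of_isMinOn Set.inter_subset_left (hYconv.inter (convex_closedBall c₂ R))
      hb hbmin hc₂B
  -- The gap at the centre is tested at the point `(x, y)` itself, which links the two growth
  -- inequalities.
  have q3 : f c₁ y - f x c₂ ≤ dualityGap X Y f c₁ c₂ :=
    sub_le_dualityGap (hmin c₂ hc₂) (hmax c₁ hc₁) hx hy
  have q4 := hreg a ha b hb
  have q5 : m * ‖a - c₁‖ ^ 2 ≤ μ * ‖a - c₁‖ ^ 2 := by gcongr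
  have q6 : m * ‖b - c₂‖ ^ 2 ≤ lam * ‖b - c₂‖ ^ 2 := by gcongr
  have hu : 0 < m * R ^ 2 := by positivity
  -- With `u = m * R ^ 2`, `S` the sum of the squared distances and `G` the left side, `m * S / 4 ≤
  -- u / 8 + G` and `G ≤ 3 * m * S / 160 + 37 * u / 800`. Eliminating `S` gives `G ≤ 89 * u / 1480 <
  -- u / 16`, and then `S ≤ 3 * R ^ 2 / 4`.
  have hG : f x b - f a y ≤ m * R ^ 2 / 16 := by linarith
  have hna : ‖a - c₁‖ < R := by
    refine lt_of_pow_lt_pow_left₀ 2 hR.le ?_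
    have : m * ‖a - c₁‖ ^ 2 < m * R ^ 2 := by
      nlinarith [mul_nonneg hm0.le (sq_nonneg ‖b - c₂‖)]
    exact lt_of_mul_lt_mul_left this hm0.le
  have hnb : ‖b - c₂‖ < R := by
    refine lt_of_pow_lt_pow_left₀ 2 hR.le ?_
    have : m * ‖b - c₂‖ ^ 2 < m * R ^ 2 := by
      nlinarith [mul_nonneg hm0.le (sq_nonneg ‖a - c₁‖)]
    exact lt_of_mul_lt_mul_left this hm0.le
  have hA : IsMinOn (fun x' => f x' y) X a :=
    (hsx.convexOn_of_pos hμ).isMinOn_of_norm_sub_lt ha.1 hamin hna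
  have hB : IsMinOn (fun y' => -f x y') Y b :=
    (hsy.convexOn_of_pos hlam).isMinOn_of_norm_sub_lt hb.1 hbmin hnb
  have r1 := hA (argminOn_spec (hmin y hy)).1
  have r2 := hB (argmaxOn_spec (hmax x hx)).1
  simp only [Set.mem_ofPred_eq] at r1 r2
  unfold dualityGap
  linarith

/-- Online-to-batch conversion: the restricted gap of the averages is at most the average regret. -/
theorem sub_average_le_of_subgradient {X : Set (EuclideanSpace ℝ (Fin d))}
    {Y : Set (EuclideanSpace ℝ (Fin n))}
    {f : EuclideanSpace ℝ (Fin d) → EuclideanSpace ℝ (Fin n) → ℝ}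
    (hfx : ∀ y ∈ Y, ConvexOn ℝ X (fun x => f x y))
    (hfy : ∀ x ∈ X, ConvexOn ℝ Y (fun y => -f x y))
    {xs g₁ : ℕ → EuclideanSpace ℝ (Fin d)} {ys g₂ : ℕ → EuclideanSpace ℝ (Fin n)}
    (hxs : ∀ t, xs t ∈ X) (hys : ∀ t, ys t ∈ Y)
    (hg₁ : ∀ t, IsSubgradientOn X (fun x => f x (ys t)) (xs t) (g₁ t))
    (hg₂ : ∀ t, IsSubgradientOn Y (fun y => -f (xs t) y) (ys t) (g₂ t))
    {T : ℕ} (hT : 0 < T) {x : EuclideanSpace ℝ (Fin d)} {y : EuclideanSpace ℝ (Fin n)}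
    (hx : x ∈ X) (hy : y ∈ Y) :
    f ((1 / (T : ℝ)) • ∑ t ∈ Finset.range T, xs t) y
        - f x ((1 / (T : ℝ)) • ∑ t ∈ Finset.range T, ys t) ≤
      1 / (T : ℝ) * (∑ t ∈ Finset.range T, inner ℝ (g₁ t) (xs t - x)
        + ∑ t ∈ Finset.range T, inner ℝ (g₂ t) (ys t - y)) := by
  have hT' : (0 : ℝ) < T := by exact_mod_cast hT
  have hw : ∑ _t ∈ Finset.range T, 1 / (T : ℝ) = 1 := by
    rw [Finset.sum_const, Finset.card_range, nsmul_eq_mul]; field_simp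
  have j1 := (hfx y hy).map_sum_le (t := Finset.range T) (w := fun _ => 1 / (T : ℝ)) (p := xs)
    (fun _ _ => by positivity) hw fun t _ => hxs t
  have j2 := (hfy x hx).map_sum_le (t := Finset.range T) (w := fun _ => 1 / (T : ℝ)) (p := ys)
    (fun _ _ => by positivity) hw fun t _ => hys t
  rw [← Finset.smul_sum] at j1 j2
  simp only [smul_eq_mul, ← Finset.mul_sum] at j1 j2
  have h : ∑ t ∈ Finset.range T, f (xs t) y + ∑ t ∈ Finset.range T, -f x (ys t) ≤
      ∑ t ∈ Finset.range T, inner ℝ (g₁ t) (xs t - x)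
        + ∑ t ∈ Finset.range T, inner ℝ (g₂ t) (ys t - y) := by
    rw [← Finset.sum_add_distrib, ← Finset.sum_add_distrib]
    refine Finset.sum_le_sum fun t _ => ?_
    -- The common value `f (xs t) (ys t)` cancels when the two inequalities are added.
    have s1 := hg₁ t x hx
    have s2 := hg₂ t y hy
    rw [← neg_sub x, ← neg_sub y, inner_neg_right, inner_neg_right]
    linarith
  have h' := mul_le_mul_of_nonneg_left h (by positivity : 0 ≤ 1 / (T : ℝ))
  linarith

end DualityGap

/-! ### Calculus of log-e-values -/

section LogEValue

variable {Ξ : Type*} [MeasurableSpace Ξ] {ν : Measure Ξ}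

/-- `A` is the logarithm of an e-value, i.e. `E[exp A] ≤ 1`. -/
def IsLogEValue (ν : Measure Ξ) (A : Ξ → ℝ) : Prop :=
  Measurable A ∧ ∫⁻ s, ENNReal.ofReal (Real.exp (A s)) ∂ν ≤ 1

theorem IsLogEValue.mono {A A' : Ξ → ℝ} (h : IsLogEValue ν A) (hA' : Measurable A')
    (hle : ∀ s, A' s ≤ A s) : IsLogEValue ν A' :=
  ⟨hA', (lintegral_mono fun s => ENNReal.ofReal_le_ofReal (Real.exp_le_exp.2 (hle s))).trans h.2⟩

theorem isLogEValue_zero [IsProbabilityMeasure ν] : IsLogEValue ν fun _ => 0 :=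
  ⟨measurable_const, by simp⟩

theorem exp_convex_combination_le {r a b : ℝ} (h0 : 0 ≤ r) (h1 : r ≤ 1) :
    Real.exp (r * a + (1 - r) * b) ≤ r * Real.exp a + (1 - r) * Real.exp b := by
  have := convexOn_exp.2 (Set.mem_univ a) (Set.mem_univ b) h0 (sub_nonneg.2 h1) (by ring)
  simpa only [smul_eq_mul] using this

/-- Convexity of `exp`. No independence is needed, so dependent quantities can share one e-value and
one failure event. -/
theorem IsLogEValue.convex_combination {A B : Ξ → ℝ} (hA : IsLogEValue ν A)
    (hB : IsLogEValue ν B) {r : ℝ} (h0 : 0 ≤ r) (h1 : r ≤ 1) :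
    IsLogEValue ν fun s => r * A s + (1 - r) * B s := by
  refine ⟨(hA.1.const_mul r).add (hB.1.const_mul (1 - r)), ?_⟩
  have h1' : 0 ≤ 1 - r := sub_nonneg.2 h1
  calc ∫⁻ s, ENNReal.ofReal (Real.exp (r * A s + (1 - r) * B s)) ∂ν
      ≤ ∫⁻ s, (ENNReal.ofReal r * ENNReal.ofReal (Real.exp (A s))
          + ENNReal.ofReal (1 - r) * ENNReal.ofReal (Real.exp (B s))) ∂ν := by
        refine lintegral_mono fun s => ?_
        rw [← ENNReal.ofReal_mul h0, ← ENNReal.ofReal_mul h1',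
          ← ENNReal.ofReal_add (by positivity) (by positivity)]
        exact ENNReal.ofReal_le_ofReal (exp_convex_combination_le h0 h1)
    _ = ENNReal.ofReal r * ∫⁻ s, ENNReal.ofReal (Real.exp (A s)) ∂ν
          + ENNReal.ofReal (1 - r) * ∫⁻ s, ENNReal.ofReal (Real.exp (B s)) ∂ν := by
        have mA := hA.1
        have mB := hB.1
        rw [lintegral_add_left (by fun_prop), lintegral_const_mul _ (by fun_prop),
          lintegral_const_mul _ (by fun_prop)]
    _ ≤ ENNReal.ofReal r * 1 + ENNReal.ofReal (1 - r) * 1 := by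
        gcongr
        · exact hA.2
        · exact hB.2
    _ = 1 := by
        rw [mul_one, mul_one, ← ENNReal.ofReal_add h0 h1']
        simp

theorem IsLogEValue.const_mul [IsProbabilityMeasure ν] {A : Ξ → ℝ} (hA : IsLogEValue ν A)
    {r : ℝ} (h0 : 0 ≤ r) (h1 : r ≤ 1) : IsLogEValue ν fun s => r * A s := by
  simpa using hA.convex_combination isLogEValue_zero h0 h1

theorem IsLogEValue.integrable_exp {A : Ξ → ℝ} (hA : IsLogEValue ν A) :
    Integrable (fun s => Real.exp (A s)) ν :=
  (lintegral_ofReal_ne_top_iff_integrable hA.1.exp.aestronglyMeasurable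
    (Filter.Eventually.of_forall fun _ => (Real.exp_pos _).le)).1
    (ne_top_of_le_ne_top ENNReal.one_ne_top hA.2)

theorem IsLogEValue.integral_exp_le {A : Ξ → ℝ} (hA : IsLogEValue ν A) :
    ∫ s, Real.exp (A s) ∂ν ≤ 1 := by
  rw [integral_eq_lintegral_of_nonneg_ae (Filter.Eventually.of_forall fun _ => (Real.exp_pos _).le)
    hA.1.exp.aestronglyMeasurable]
  exact ENNReal.toReal_le_of_le_ofReal zero_le_one (by simpa using hA.2)

/-- The linear term integrates to zero for a centred variable, leaving only the moment of its
square. For `|x| ≤ 1` this is a Taylor bound; beyond that, `x ≤ x ^ 2` or `exp x ≤ 1` suffices. -/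
theorem exp_le_add_exp_sq (x : ℝ) : Real.exp x ≤ x + Real.exp (x ^ 2) := by
  have h2 := Real.add_one_le_exp (x ^ 2)
  rcases le_or_gt |x| 1 with h | h
  · have := (abs_le.1 (Real.abs_exp_sub_one_sub_id_le h)).2
    linarith
  · rcases lt_abs.1 h with h | h
    · have : Real.exp x ≤ Real.exp (x ^ 2) := Real.exp_le_exp.2 (by nlinarith)
      linarith
    · have : Real.exp x ≤ 1 := Real.exp_le_one_iff.2 (by linarith)
      nlinarith

/-- A centred variable with sub-Gaussian tails of scale `σ` has a Gaussian moment generating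
function. -/
theorem IsLogEValue.mgf_of_sq [IsProbabilityMeasure ν] {D : Ξ → ℝ} {σ : ℝ} (hσ : 0 < σ)
    (hDm : Measurable D) (hDi : Integrable D ν) (hD0 : ∫ s, D s ∂ν = 0)
    (hD : IsLogEValue ν fun s => D s ^ 2 / σ ^ 2 - 1) (θ : ℝ) :
    IsLogEValue ν fun s => θ * D s - θ ^ 2 * σ ^ 2 := by
  have hm : Measurable fun s => θ * D s - θ ^ 2 * σ ^ 2 := (hDm.const_mul θ).sub_const _
  rcases le_or_gt (θ ^ 2 * σ ^ 2) 1 with h | h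
  · refine ⟨hm, ?_⟩
    -- Here `θ ^ 2 * σ ^ 2 ≤ 1` serves as the mixing weight, turning the hypothesis on `D ^ 2 / σ ^
    -- 2` into one on `(θ * D) ^ 2`.
    have hr := hD.const_mul (r := θ ^ 2 * σ ^ 2) (by positivity) h
    set c := Real.exp (-(θ ^ 2 * σ ^ 2)) with hc
    have hle : ∀ s, Real.exp (θ * D s - θ ^ 2 * σ ^ 2) ≤
        c * (θ * D s) + Real.exp (θ ^ 2 * σ ^ 2 * (D s ^ 2 / σ ^ 2 - 1)) := by
      intro s
      have e1 : θ ^ 2 * σ ^ 2 * (D s ^ 2 / σ ^ 2 - 1) = (θ * D s) ^ 2 + -(θ ^ 2 * σ ^ 2) := by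
        field_simp
        ring
      rw [sub_eq_add_neg, e1, Real.exp_add, Real.exp_add, ← hc]
      have := mul_le_mul_of_nonneg_left (exp_le_add_exp_sq (θ * D s)) (Real.exp_pos _ : 0 < c).le
      linarith
    have hi1 : Integrable (fun s => c * (θ * D s)) ν := (hDi.const_mul θ).const_mul c
    calc ∫⁻ s, ENNReal.ofReal (Real.exp (θ * D s - θ ^ 2 * σ ^ 2)) ∂ν
        ≤ ∫⁻ s, ENNReal.ofReal (c * (θ * D s)
            + Real.exp (θ ^ 2 * σ ^ 2 * (D s ^ 2 / σ ^ 2 - 1))) ∂ν :=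
          lintegral_mono fun s => ENNReal.ofReal_le_ofReal (hle s)
      _ = ENNReal.ofReal (∫ s, (c * (θ * D s)
            + Real.exp (θ ^ 2 * σ ^ 2 * (D s ^ 2 / σ ^ 2 - 1))) ∂ν) := by
          refine (ofReal_integral_eq_lintegral_ofReal (hi1.add hr.integrable_exp) ?_).symm
          exact Filter.Eventually.of_forall fun s => (Real.exp_pos _).le.trans (hle s)
      _ ≤ ENNReal.ofReal 1 := by
          refine ENNReal.ofReal_le_ofReal ?_
          rw [integral_add hi1 hr.integrable_exp, integral_const_mul, integral_const_mul, hD0]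
          have := hr.integral_exp_le
          linarith
      _ = 1 := ENNReal.ofReal_one
  -- For large `θ`, `2 * θ * D ≤ θ ^ 2 * σ ^ 2 + D ^ 2 / σ ^ 2` already suffices, without centring.
  · refine (hD.const_mul (r := 1 / 2) (by norm_num) (by norm_num)).mono hm fun s => ?_
    have h1 : 0 ≤ (θ * σ - D s / σ) ^ 2 := sq_nonneg _
    have h2 : (θ * σ - D s / σ) ^ 2 = θ ^ 2 * σ ^ 2 - 2 * (θ * D s) + D s ^ 2 / σ ^ 2 := by
      field_simp
      ring
    linarith

end LogEValue

/-! ### Exponential moments of one stochastic step -/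

section SubGaussian

variable {Ξ : Type*} [MeasurableSpace Ξ] {ν : Measure Ξ} {d n : ℕ}

theorem SubGaussianNorm.isLogEValue {V : Ξ → EuclideanSpace ℝ (Fin d)} {B : ℝ}
    (hV : SubGaussianNorm ν V B) (hVm : Measurable V) :
    IsLogEValue ν fun s => ‖V s‖ ^ 2 / B ^ 2 - 1 := by
  refine ⟨((hVm.norm.pow_const 2).div_const _).sub_const _, ?_⟩
  have : ∀ s, ENNReal.ofReal (Real.exp (‖V s‖ ^ 2 / B ^ 2 - 1)) =
      ENNReal.ofReal (Real.exp (-1)) * ENNReal.ofReal (Real.exp (‖V s‖ ^ 2 / B ^ 2)) := by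
    intro s
    rw [← ENNReal.ofReal_mul (Real.exp_pos _).le, ← Real.exp_add]
    congr 2
    ring
  simp only [this]
  rw [lintegral_const_mul _ (by fun_prop)]
  calc _ ≤ ENNReal.ofReal (Real.exp (-1)) * ENNReal.ofReal (Real.exp 1) := by gcongr; exact hV
    _ = 1 := by
      rw [← ENNReal.ofReal_mul (Real.exp_pos _).le, ← Real.exp_add]
      simp

/-- From `2 * t ≤ t ^ 2 + 1` and `t ^ 2 ≤ exp (t ^ 2 - 1)` at `t = a / B`. Equality at `a = B` is
what yields the bound `B` on the mean with no loss. -/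
theorem norm_le_of_exp_sq {a B : ℝ} (hB : 0 < B) :
    a ≤ B * (1 / 2 + 1 / 2 * Real.exp (a ^ 2 / B ^ 2 - 1)) := by
  have h1 := Real.add_one_le_exp (a ^ 2 / B ^ 2 - 1)
  have h2 : 0 ≤ (a / B - 1) ^ 2 := sq_nonneg _
  have h3 : (a / B - 1) ^ 2 = a ^ 2 / B ^ 2 - 2 * (a / B) + 1 := by ring
  have h4 : a / B ≤ 1 / 2 + 1 / 2 * Real.exp (a ^ 2 / B ^ 2 - 1) := by linarith
  calc a = B * (a / B) := by field_simp
    _ ≤ _ := by gcongr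

theorem SubGaussianNorm.integrable [IsProbabilityMeasure ν] {V : Ξ → EuclideanSpace ℝ (Fin d)}
    {B : ℝ} (hV : SubGaussianNorm ν V B) (hVm : Measurable V) (hB : 0 < B) : Integrable V ν := by
  have hi := (hV.isLogEValue hVm).integrable_exp
  refine Integrable.mono' (((integrable_const (1 / 2)).add (hi.const_mul (1 / 2))).const_mul B)
    hVm.aestronglyMeasurable (Filter.Eventually.of_forall fun s => ?_)
  exact norm_le_of_exp_sq hB

theorem SubGaussianNorm.norm_integral_le [IsProbabilityMeasure ν]
    {V : Ξ → EuclideanSpace ℝ (Fin d)} {B : ℝ} (hV : SubGaussianNorm ν V B) (hVm : Measurable V)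
    (hB : 0 < B) : ‖∫ s, V s ∂ν‖ ≤ B := by
  have hi := (hV.isLogEValue hVm).integrable_exp
  have h1 := (hV.isLogEValue hVm).integral_exp_le
  calc ‖∫ s, V s ∂ν‖ ≤ ∫ s, ‖V s‖ ∂ν := norm_integral_le_integral_norm _
    _ ≤ ∫ s, B * (1 / 2 + 1 / 2 * Real.exp (‖V s‖ ^ 2 / B ^ 2 - 1)) ∂ν :=
        integral_mono (hV.integrable hVm hB).norm
          (((integrable_const (1 / 2)).add (hi.const_mul (1 / 2))).const_mul B)
          fun s => norm_le_of_exp_sq hB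
    _ ≤ B := by
        rw [integral_const_mul, integral_add (integrable_const _) (hi.const_mul _),
          integral_const_mul, integral_const]
        simp only [probReal_univ, one_smul]
        nlinarith

/-- The quotient `(a₁ + a₂) / (B₁ + B₂)` is the average of the `aᵢ / Bᵢ` with weights `Bᵢ / (B₁ +
B₂)`, so convexity of the square applies twice. This makes the scale of the joint noise `B₁ + B₂`.
-/
theorem add_sq_div_le {a₁ a₂ B₁ B₂ : ℝ} (hB₁ : 0 < B₁) (hB₂ : 0 < B₂) :
    (a₁ + B₁ + (a₂ + B₂)) ^ 2 / (4 * (B₁ + B₂) ^ 2) ≤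
      1 / 2 * (B₁ / (B₁ + B₂) * (a₁ ^ 2 / B₁ ^ 2 - 1)
        + (1 - B₁ / (B₁ + B₂)) * (a₂ ^ 2 / B₂ ^ 2 - 1)) + 1 := by
  have e : 1 / 2 * (B₁ / (B₁ + B₂) * (a₁ ^ 2 / B₁ ^ 2 - 1)
      + (1 - B₁ / (B₁ + B₂)) * (a₂ ^ 2 / B₂ ^ 2 - 1)) + 1
      - (a₁ + B₁ + (a₂ + B₂)) ^ 2 / (4 * (B₁ + B₂) ^ 2)
      = ((a₁ + a₂ - (B₁ + B₂)) ^ 2 * (B₁ * B₂) + 2 * (B₂ * a₁ - B₁ * a₂) ^ 2)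
        / (4 * (B₁ + B₂) ^ 2 * (B₁ * B₂)) := by
    field_simp
    ring
  have : 0 ≤ ((a₁ + a₂ - (B₁ + B₂)) ^ 2 * (B₁ * B₂) + 2 * (B₂ * a₁ - B₁ * a₂) ^ 2)
        / (4 * (B₁ + B₂) ^ 2 * (B₁ * B₂)) := by positivity
  linarith

/-- The exponent of the e-value attached to one stochastic step, with noisy directions `V₁`, `V₂`
and (predictable) displacements `u₁`, `u₂` of norm at most `2 * R`. -/
noncomputable def stepExponent (ν : Measure Ξ) (V₁ : Ξ → EuclideanSpace ℝ (Fin d))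
    (V₂ : Ξ → EuclideanSpace ℝ (Fin n)) (B₁ B₂ R r θ : ℝ) (u₁ : EuclideanSpace ℝ (Fin d))
    (u₂ : EuclideanSpace ℝ (Fin n)) (s : Ξ) : ℝ :=
  r * ((‖V₁ s‖ ^ 2 / B₁ ^ 2 + ‖V₂ s‖ ^ 2 / B₂ ^ 2) / 2 - 1)
    + (1 - r) * (θ * (inner ℝ ((∫ s', V₁ s' ∂ν) - V₁ s) u₁ + inner ℝ ((∫ s', V₂ s' ∂ν) - V₂ s) u₂)
      - θ ^ 2 * (4 * (R * (B₁ + B₂))) ^ 2)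

/-- The first bracket averages the two given moment bounds. The second is the Gaussian bound for a
centred variable of scale `σ = 4 * R * (B₁ + B₂)`: displacements contribute `2 * R`, and centring
doubles the scale. -/
theorem isLogEValue_stepExponent [IsProbabilityMeasure ν] {V₁ : Ξ → EuclideanSpace ℝ (Fin d)}
    {V₂ : Ξ → EuclideanSpace ℝ (Fin n)} {B₁ B₂ R r : ℝ}
    (hV₁ : SubGaussianNorm ν V₁ B₁) (hV₂ : SubGaussianNorm ν V₂ B₂) (hV₁m : Measurable V₁)
    (hV₂m : Measurable V₂) (hB₁ : 0 < B₁) (hB₂ : 0 < B₂) (hR : 0 < R) (hr0 : 0 ≤ r) (hr1 : r ≤ 1)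
    (θ : ℝ) {u₁ : EuclideanSpace ℝ (Fin d)} {u₂ : EuclideanSpace ℝ (Fin n)}
    (hu₁ : ‖u₁‖ ≤ 2 * R) (hu₂ : ‖u₂‖ ≤ 2 * R) :
    IsLogEValue ν (stepExponent ν V₁ V₂ B₁ B₂ R r θ u₁ u₂) := by
  have hE₁ := hV₁.isLogEValue hV₁m
  have hE₂ := hV₂.isLogEValue hV₂m
  have hi₁ := hV₁.integrable hV₁m hB₁
  have hi₂ := hV₂.integrable hV₂m hB₂
  have hn₁ := hV₁.norm_integral_le hV₁m hB₁
  have hn₂ := hV₂.norm_integral_le hV₂m hB₂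
  set M₁ := ∫ s', V₁ s' ∂ν with hM₁
  set M₂ := ∫ s', V₂ s' ∂ν with hM₂
  have hA : IsLogEValue ν fun s => (‖V₁ s‖ ^ 2 / B₁ ^ 2 + ‖V₂ s‖ ^ 2 / B₂ ^ 2) / 2 - 1 := by
    refine (hE₁.convex_combination hE₂ (r := 1 / 2) (by norm_num) (by norm_num)).mono
      (by fun_prop) fun s => ?_
    linarith
  have hc₁ : Integrable (fun s => M₁ - V₁ s) ν := (integrable_const _).sub hi₁
  have hc₂ : Integrable (fun s => M₂ - V₂ s) ν := (integrable_const _).sub hi₂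
  have hz₁ : ∫ s, inner ℝ (M₁ - V₁ s) u₁ ∂ν = 0 := by
    simp only [real_inner_comm u₁]
    rw [integral_inner hc₁, integral_sub (integrable_const _) hi₁]
    simp [hM₁]
  have hz₂ : ∫ s, inner ℝ (M₂ - V₂ s) u₂ ∂ν = 0 := by
    simp only [real_inner_comm u₂]
    rw [integral_inner hc₂, integral_sub (integrable_const _) hi₂]
    simp [hM₂]
  set D : Ξ → ℝ := fun s => inner ℝ (M₁ - V₁ s) u₁ + inner ℝ (M₂ - V₂ s) u₂ with hD
  have hDm : Measurable D := by fun_prop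
  have hDi : Integrable D ν := (hc₁.inner_const u₁).add (hc₂.inner_const u₂)
  have hD0 : ∫ s, D s ∂ν = 0 := by
    rw [hD, integral_add (hc₁.inner_const u₁) (hc₂.inner_const u₂), hz₁, hz₂, add_zero]
  have hβ : B₁ / (B₁ + B₂) ≤ 1 := (div_le_one (by positivity)).2 (by linarith)
  have hDsq : IsLogEValue ν fun s => D s ^ 2 / (4 * (R * (B₁ + B₂))) ^ 2 - 1 := by
    refine ((hE₁.convex_combination hE₂ (r := B₁ / (B₁ + B₂)) (by positivity) hβ).const_mul
      (r := 1 / 2) (by norm_num) (by norm_num)).mono (by fun_prop) fun s => ?_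
    have hb₁ : |inner ℝ (M₁ - V₁ s) u₁| ≤ (‖V₁ s‖ + B₁) * (2 * R) := by
      refine (abs_real_inner_le_norm _ _).trans ?_
      have := norm_sub_le M₁ (V₁ s)
      gcongr
      linarith
    have hb₂ : |inner ℝ (M₂ - V₂ s) u₂| ≤ (‖V₂ s‖ + B₂) * (2 * R) := by
      refine (abs_real_inner_le_norm _ _).trans ?_
      have := norm_sub_le M₂ (V₂ s)
      gcongr
      linarith
    have hb : |D s| ≤ (‖V₁ s‖ + B₁ + (‖V₂ s‖ + B₂)) * (2 * R) := by
      refine (abs_add_le _ _).trans ?_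
      linarith
    have hb2 : D s ^ 2 / (4 * (R * (B₁ + B₂))) ^ 2 ≤
        (‖V₁ s‖ + B₁ + (‖V₂ s‖ + B₂)) ^ 2 / (4 * (B₁ + B₂) ^ 2) := by
      rw [← sq_abs (D s)]
      calc |D s| ^ 2 / (4 * (R * (B₁ + B₂))) ^ 2
          ≤ ((‖V₁ s‖ + B₁ + (‖V₂ s‖ + B₂)) * (2 * R)) ^ 2 / (4 * (R * (B₁ + B₂))) ^ 2 := by gcongr
        _ = _ := by field_simp; ring
    have := add_sq_div_le (a₁ := ‖V₁ s‖) (a₂ := ‖V₂ s‖) hB₁ hB₂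
    linarith
  exact hA.convex_combination
    (IsLogEValue.mgf_of_sq (by positivity) hDm hDi hD0 hDsq θ) hr0 hr1

end SubGaussian

/-! ### Integrating out a fresh sample -/

section Independence

/-- By independence, Fubini integrates the fresh sample first with the past `(Φ, Z)` frozen; each
inner integral is then at most `Φ`. This replaces a conditional expectation. -/
theorem lintegral_mul_le_of_indep {Ω α Ξ : Type*} {m mΩ : MeasurableSpace Ω} [MeasurableSpace α]
    [MeasurableSpace Ξ] {P : Measure Ω} [IsProbabilityMeasure P] {ν : Measure Ξ}
    [IsProbabilityMeasure ν] {ξ : Ω → Ξ} (hξ : Measurable ξ) (hlaw : P.map ξ = ν)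
    (hm : m ≤ mΩ)
    (hind : Indep m (MeasurableSpace.comap ξ inferInstance) P)
    {Z : Ω → α} (hZ : Measurable[m] Z) {Φ : Ω → ENNReal} (hΦ : Measurable[m] Φ)
    {w : α → Ξ → ENNReal} (hw : Measurable (Function.uncurry w))
    (hle : ∀ ω, ∫⁻ s, w (Z ω) s ∂ν ≤ 1) :
    ∫⁻ ω, Φ ω * w (Z ω) (ξ ω) ∂P ≤ ∫⁻ ω, Φ ω ∂P := by
  have hpair : Measurable[m] fun ω => (Φ ω, Z ω) := hΦ.prodMk hZ
  have hpair' : Measurable fun ω => (Φ ω, Z ω) := hpair.mono hm le_rfl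
  have hif : IndepFun (fun ω => (Φ ω, Z ω)) ξ P := by
    rw [IndepFun_iff_Indep]
    exact indep_of_indep_of_le_left hind hpair.comap_le
  have hlaw2 := (indepFun_iff_map_prod_eq_prod_map_map hpair'.aemeasurable
    hξ.aemeasurable).1 hif
  rw [hlaw] at hlaw2
  have hF : Measurable fun q : (ENNReal × α) × Ξ => q.1.1 * w q.1.2 q.2 :=
    (measurable_fst.comp measurable_fst).mul
      (hw.comp ((measurable_snd.comp measurable_fst).prodMk measurable_snd))
  calc ∫⁻ ω, Φ ω * w (Z ω) (ξ ω) ∂P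
      = ∫⁻ q, q.1.1 * w q.1.2 q.2 ∂(P.map fun ω => ((Φ ω, Z ω), ξ ω)) :=
        (lintegral_map hF (hpair'.prodMk hξ)).symm
    _ = ∫⁻ a, ∫⁻ s, a.1 * w a.2 s ∂ν ∂(P.map fun ω => (Φ ω, Z ω)) := by
        rw [hlaw2, lintegral_prod _ hF.aemeasurable]
    _ = ∫⁻ ω, ∫⁻ s, Φ ω * w (Z ω) s ∂ν ∂P :=
        lintegral_map (f := fun a : ENNReal × α => ∫⁻ s, a.1 * w a.2 s ∂ν)
          hF.lintegral_prod_right' hpair'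
    _ ≤ ∫⁻ ω, Φ ω ∂P := by
        refine lintegral_mono fun ω => ?_
        have hws : Measurable (w (Z ω)) := hw.of_uncurry_left
        show ∫⁻ s, Φ ω * w (Z ω) s ∂ν ≤ Φ ω
        rw [lintegral_const_mul _ hws]
        exact mul_le_of_le_one_right' (hle ω)

end Independence

/-! ### Iterates: regret form, membership, parameters, measurability -/

section Iterates

variable {Ξ : Type*} {d n : ℕ}
  {X : Set (EuclideanSpace ℝ (Fin d))} {Y : Set (EuclideanSpace ℝ (Fin n))}
  {Gx : EuclideanSpace ℝ (Fin d) → EuclideanSpace ℝ (Fin n) → Ξ → EuclideanSpace ℝ (Fin d)}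
  {Gy : EuclideanSpace ℝ (Fin d) → EuclideanSpace ℝ (Fin n) → Ξ → EuclideanSpace ℝ (Fin n)}
  {p : EpochParams}

/-- The players are coupled only through the directions. Once these are frozen, each player performs
plain projected descent, the second one along `-Gy`, so the deterministic regret bound applies to
each. -/
theorem innerIterate_eq_projDescent (x₀ : EuclideanSpace ℝ (Fin d))
    (y₀ : EuclideanSpace ℝ (Fin n)) (s : ℕ → Ξ) (t : ℕ) :
    innerIterate X Y Gx Gy p x₀ y₀ s t =
      (projDescent (X ∩ Metric.closedBall x₀ p.R) p.ηx (fun t =>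
          Gx (innerIterate X Y Gx Gy p x₀ y₀ s t).1 (innerIterate X Y Gx Gy p x₀ y₀ s t).2 (s t))
          x₀ t,
        projDescent (Y ∩ Metric.closedBall y₀ p.R) p.ηy (fun t =>
          -Gy (innerIterate X Y Gx Gy p x₀ y₀ s t).1 (innerIterate X Y Gx Gy p x₀ y₀ s t).2 (s t))
          y₀ t) := by
  induction t with
  | zero => rfl
  | succ t ih =>
    have h1 := congrArg Prod.fst ih
    have h2 := congrArg Prod.snd ih
    simp only at h1 h2
    rw [projDescent, projDescent, ← h1, ← h2, innerIterate, smul_neg, sub_neg_eq_add]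

theorem innerIterate_mem (hX : IsClosed X) (hY : IsClosed Y) (hR : 0 ≤ p.R)
    {x₀ : EuclideanSpace ℝ (Fin d)} {y₀ : EuclideanSpace ℝ (Fin n)} (hx₀ : x₀ ∈ X) (hy₀ : y₀ ∈ Y)
    (s : ℕ → Ξ) (t : ℕ) :
    (innerIterate X Y Gx Gy p x₀ y₀ s t).1 ∈ X ∩ Metric.closedBall x₀ p.R ∧
      (innerIterate X Y Gx Gy p x₀ y₀ s t).2 ∈ Y ∩ Metric.closedBall y₀ p.R := by
  rw [innerIterate_eq_projDescent]
  exact ⟨projDescent_mem (hX.inter Metric.isClosed_closedBall)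
      ⟨hx₀, Metric.mem_closedBall_self hR⟩ t,
    projDescent_mem (hY.inter Metric.isClosed_closedBall) ⟨hy₀, Metric.mem_closedBall_self hR⟩ t⟩

theorem average_mem {C : Set (EuclideanSpace ℝ (Fin d))} (hC : Convex ℝ C)
    {u : ℕ → EuclideanSpace ℝ (Fin d)} (hu : ∀ t, u t ∈ C) {T : ℕ} (hT : 0 < T) :
    (1 / (T : ℝ)) • ∑ t ∈ Finset.range T, u t ∈ C := by
  have hT' : (0 : ℝ) < T := by exact_mod_cast hT
  rw [Finset.smul_sum]
  refine hC.sum_mem (fun _ _ => by positivity) ?_ fun t _ => hu t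
  rw [Finset.sum_const, Finset.card_range, nsmul_eq_mul]
  field_simp

theorem epochParams_R (k : ℕ) : (epochParams p k).R = p.R / √2 ^ k := by
  induction k with
  | zero => simp [epochParams]
  | succ k ih => rw [epochParams, EpochParams.next, ih, pow_succ]; simp only; field_simp

theorem epochParams_ηx (k : ℕ) : (epochParams p k).ηx = p.ηx / 2 ^ k := by
  induction k with
  | zero => simp [epochParams]
  | succ k ih => rw [epochParams, EpochParams.next, ih, pow_succ]; simp only; field_simp

theorem epochParams_ηy (k : ℕ) : (epochParams p k).ηy = p.ηy / 2 ^ k := by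
  induction k with
  | zero => simp [epochParams]
  | succ k ih => rw [epochParams, EpochParams.next, ih, pow_succ]; simp only; field_simp

theorem epochParams_T (k : ℕ) : (epochParams p k).T = 2 ^ k * p.T := by
  induction k with
  | zero => simp [epochParams]
  | succ k ih => rw [epochParams, EpochParams.next, ih, pow_succ]; simp only; ring

theorem epochGDA_mem (hX : IsClosed X) (hXconv : Convex ℝ X) (hY : IsClosed Y)
    (hYconv : Convex ℝ Y) (hR : 0 < p.R) (hT : 0 < p.T)
    {x₀ : EuclideanSpace ℝ (Fin d)} {y₀ : EuclideanSpace ℝ (Fin n)} (hx₀ : x₀ ∈ X) (hy₀ : y₀ ∈ Y)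
    (s : ℕ → ℕ → Ξ) (k : ℕ) :
    (epochGDA X Y Gx Gy p x₀ y₀ s k).1 ∈ X ∧ (epochGDA X Y Gx Gy p x₀ y₀ s k).2 ∈ Y := by
  induction k with
  | zero => exact ⟨hx₀, hy₀⟩
  | succ k ih =>
    have hRk : 0 ≤ (epochParams p k).R := by rw [epochParams_R]; positivity
    have hTk : 0 < (epochParams p k).T := by rw [epochParams_T]; positivity
    exact ⟨average_mem hXconv (fun t => (innerIterate_mem hX hY hRk ih.1 ih.2 (s k) t).1.1) hTk,
      average_mem hYconv (fun t => (innerIterate_mem hX hY hRk ih.1 ih.2 (s k) t).2.1) hTk⟩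

section Measurability

variable {α : Type*} {mα : MeasurableSpace α} [MeasurableSpace Ξ]

theorem measurable_projDescent (hX : IsClosed X) (hXconv : Convex ℝ X) {R : ℝ} (hR : 0 < R)
    {c : α → EuclideanSpace ℝ (Fin d)} (hc : Measurable c) (hcX : ∀ a, c a ∈ X) (η : ℝ)
    (v : ℕ → α → EuclideanSpace ℝ (Fin d)) (t : ℕ) (hv : ∀ j < t, Measurable (v j)) :
    Measurable fun a =>
      projDescent (X ∩ Metric.closedBall (c a) R) η (fun j => v j a) (c a) t := by
  induction t with
  | zero => exact hc
  | succ t ih =>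
    exact measurable_euclProj_inter_closedBall hX hXconv hR hc hcX
      ((ih fun j hj => hv j (hj.trans t.lt_succ_self)).sub ((hv t t.lt_succ_self).const_smul η))

theorem measurable_innerIterate (hX : IsClosed X) (hXconv : Convex ℝ X) (hY : IsClosed Y)
    (hYconv : Convex ℝ Y) (hR : 0 < p.R)
    (hGxm : Measurable fun q : EuclideanSpace ℝ (Fin d) × EuclideanSpace ℝ (Fin n) × Ξ =>
      Gx q.1 q.2.1 q.2.2)
    (hGym : Measurable fun q : EuclideanSpace ℝ (Fin d) × EuclideanSpace ℝ (Fin n) × Ξ =>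
      Gy q.1 q.2.1 q.2.2)
    {c₁ : α → EuclideanSpace ℝ (Fin d)} (hc₁ : Measurable c₁) (hc₁X : ∀ a, c₁ a ∈ X)
    {c₂ : α → EuclideanSpace ℝ (Fin n)} (hc₂ : Measurable c₂) (hc₂Y : ∀ a, c₂ a ∈ Y)
    (s : ℕ → α → Ξ) (t : ℕ) (hs : ∀ j < t, Measurable (s j)) :
    Measurable fun a => innerIterate X Y Gx Gy p (c₁ a) (c₂ a) (fun j => s j a) t := by
  induction t with
  | zero => exact hc₁.prodMk hc₂
  | succ t ih =>
    have h := ih fun j hj => hs j (hj.trans t.lt_succ_self)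
    have hst := hs t t.lt_succ_self
    have hx := hGxm.comp (h.fst.prodMk (h.snd.prodMk hst))
    have hy := hGym.comp (h.fst.prodMk (h.snd.prodMk hst))
    exact (measurable_euclProj_inter_closedBall hX hXconv hR hc₁ hc₁X
      (h.fst.sub (hx.const_smul p.ηx))).prodMk
      (measurable_euclProj_inter_closedBall hY hYconv hR hc₂ hc₂Y
      (h.snd.add (hy.const_smul p.ηy)))

theorem measurable_epochGDA (hX : IsClosed X) (hXconv : Convex ℝ X) (hY : IsClosed Y)
    (hYconv : Convex ℝ Y) (hR : 0 < p.R) (hT : 0 < p.T)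
    (hGxm : Measurable fun q : EuclideanSpace ℝ (Fin d) × EuclideanSpace ℝ (Fin n) × Ξ =>
      Gx q.1 q.2.1 q.2.2)
    (hGym : Measurable fun q : EuclideanSpace ℝ (Fin d) × EuclideanSpace ℝ (Fin n) × Ξ =>
      Gy q.1 q.2.1 q.2.2)
    {x₀ : EuclideanSpace ℝ (Fin d)} {y₀ : EuclideanSpace ℝ (Fin n)} (hx₀ : x₀ ∈ X) (hy₀ : y₀ ∈ Y)
    (s : ℕ → ℕ → α → Ξ) (k : ℕ) (hs : ∀ i < k, ∀ j, Measurable (s i j)) :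
    Measurable fun a => epochGDA X Y Gx Gy p x₀ y₀ (fun i j => s i j a) k := by
  induction k with
  | zero => exact measurable_const
  | succ k ih =>
    have h := ih fun i hi => hs i (hi.trans k.lt_succ_self)
    have hRk : 0 < (epochParams p k).R := by rw [epochParams_R]; positivity
    have hmem := fun a => epochGDA_mem (Gx := Gx) (Gy := Gy) hX hXconv hY hYconv hR hT hx₀ hy₀
      (fun i j => s i j a) k
    have hin := fun t => measurable_innerIterate hX hXconv hY hYconv hRk hGxm hGym h.fst
      (fun a => (hmem a).1) h.snd (fun a => (hmem a).2) (s k) t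
      fun j _ => hs k k.lt_succ_self j
    exact ((Finset.measurable_sum _ fun t _ => (hin t).fst).const_smul (1 / ((epochParams p k).T : ℝ))).prodMk
      ((Finset.measurable_sum _ fun t _ => (hin t).snd).const_smul (1 / ((epochParams p k).T : ℝ)))

end Measurability

end Iterates

/-- The exponentials of the partial sums form a supermartingale: `Z t` is known before sample `t` is
drawn. -/
theorem isLogEValue_sum_of_indep {Ω α Ξ : Type*} {mΩ : MeasurableSpace Ω} [MeasurableSpace α]
    [MeasurableSpace Ξ] {P : Measure Ω} [IsProbabilityMeasure P] {ν : Measure Ξ}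
    [IsProbabilityMeasure ν] {m : ℕ → MeasurableSpace Ω} (hm : ∀ t, m t ≤ mΩ) (hmono : Monotone m)
    {s : ℕ → Ω → Ξ} (hs : ∀ t, Measurable[m (t + 1)] (s t)) (hlaw : ∀ t, P.map (s t) = ν)
    (hind : ∀ t, Indep (m t) (MeasurableSpace.comap (s t) inferInstance) P)
    {w : α → Ξ → ℝ} (hw : Measurable (Function.uncurry w))
    {Z : ℕ → Ω → α} (hZ : ∀ t, Measurable[m t] (Z t))
    (hle : ∀ t ω, IsLogEValue ν (w (Z t ω))) (T : ℕ) :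
    IsLogEValue P fun ω => ∑ t ∈ Finset.range T, w (Z t ω) (s t ω) := by
  have hW : ∀ t, Measurable[m (t + 1)] fun ω => w (Z t ω) (s t ω) := fun t =>
    hw.comp (((hZ t).mono (hmono t.le_succ) le_rfl).prodMk (hs t))
  have hsum : ∀ T, Measurable[m T] fun ω => ∑ t ∈ Finset.range T, w (Z t ω) (s t ω) := fun T =>
    Finset.measurable_sum _ fun t ht => (hW t).mono (hmono (Finset.mem_range.1 ht)) le_rfl
  refine ⟨(hsum T).mono (hm T) le_rfl, ?_⟩
  induction T with
  | zero => simp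
  | succ T ih =>
    simp only [Finset.sum_range_succ, Real.exp_add, ENNReal.ofReal_mul (Real.exp_pos _).le]
    exact (lintegral_mul_le_of_indep (ν := ν) (w := fun z s' => ENNReal.ofReal (Real.exp (w z s')))
      ((hs T).mono (hm _) le_rfl) (hlaw T) (hm T) (hind T) (hZ T)
      (ENNReal.measurable_ofReal.comp (Real.measurable_exp.comp (hsum T)))
      (ENNReal.measurable_ofReal.comp (Real.measurable_exp.comp hw)) fun ω => (hle T ω).2).trans ih

/-! ### The e-value of one epoch -/

section EpochExponent

variable {Ξ : Type*} [MeasurableSpace Ξ] {d n : ℕ}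

/-- Auxiliary descent along the errors of the stochastic directions of one epoch. -/
noncomputable def ghostIterate (ν : Measure Ξ)
    (X : Set (EuclideanSpace ℝ (Fin d))) (Y : Set (EuclideanSpace ℝ (Fin n)))
    (Gx : EuclideanSpace ℝ (Fin d) → EuclideanSpace ℝ (Fin n) → Ξ → EuclideanSpace ℝ (Fin d))
    (Gy : EuclideanSpace ℝ (Fin d) → EuclideanSpace ℝ (Fin n) → Ξ → EuclideanSpace ℝ (Fin n))
    (p : EpochParams) (x₀ : EuclideanSpace ℝ (Fin d)) (y₀ : EuclideanSpace ℝ (Fin n))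
    (s : ℕ → Ξ) (t : ℕ) : EuclideanSpace ℝ (Fin d) × EuclideanSpace ℝ (Fin n) :=
  (projDescent (X ∩ Metric.closedBall x₀ p.R) (p.ηx / 2) (fun j =>
      (∫ s', Gx (innerIterate X Y Gx Gy p x₀ y₀ s j).1 (innerIterate X Y Gx Gy p x₀ y₀ s j).2 s' ∂ν)
      - Gx (innerIterate X Y Gx Gy p x₀ y₀ s j).1 (innerIterate X Y Gx Gy p x₀ y₀ s j).2 (s j))
      x₀ t,
    projDescent (Y ∩ Metric.closedBall y₀ p.R) (p.ηy / 2) (fun j =>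
      (∫ s', -Gy (innerIterate X Y Gx Gy p x₀ y₀ s j).1 (innerIterate X Y Gx Gy p x₀ y₀ s j).2 s'
        ∂ν)
      - -Gy (innerIterate X Y Gx Gy p x₀ y₀ s j).1 (innerIterate X Y Gx Gy p x₀ y₀ s j).2 (s j))
      y₀ t)

/-- `stepExponent` along the iterates of one epoch. -/
noncomputable def epochExponent (ν : Measure Ξ)
    (X : Set (EuclideanSpace ℝ (Fin d))) (Y : Set (EuclideanSpace ℝ (Fin n)))
    (Gx : EuclideanSpace ℝ (Fin d) → EuclideanSpace ℝ (Fin n) → Ξ → EuclideanSpace ℝ (Fin d))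
    (Gy : EuclideanSpace ℝ (Fin d) → EuclideanSpace ℝ (Fin n) → Ξ → EuclideanSpace ℝ (Fin n))
    (B₁ B₂ r θ : ℝ)
    (p : EpochParams) (x₀ : EuclideanSpace ℝ (Fin d)) (y₀ : EuclideanSpace ℝ (Fin n))
    (s : ℕ → Ξ) (t : ℕ) : ℝ :=
  stepExponent ν
    (Gx (innerIterate X Y Gx Gy p x₀ y₀ s t).1 (innerIterate X Y Gx Gy p x₀ y₀ s t).2)
    (fun s' => -Gy (innerIterate X Y Gx Gy p x₀ y₀ s t).1
      (innerIterate X Y Gx Gy p x₀ y₀ s t).2 s') B₁ B₂ p.R r θ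
    ((innerIterate X Y Gx Gy p x₀ y₀ s t).1 - (ghostIterate ν X Y Gx Gy p x₀ y₀ s t).1)
    ((innerIterate X Y Gx Gy p x₀ y₀ s t).2 - (ghostIterate ν X Y Gx Gy p x₀ y₀ s t).2) (s t)

variable {X : Set (EuclideanSpace ℝ (Fin d))} {Y : Set (EuclideanSpace ℝ (Fin n))}
  {Gx : EuclideanSpace ℝ (Fin d) → EuclideanSpace ℝ (Fin n) → Ξ → EuclideanSpace ℝ (Fin d)}
  {Gy : EuclideanSpace ℝ (Fin d) → EuclideanSpace ℝ (Fin n) → Ξ → EuclideanSpace ℝ (Fin n)}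
  {p : EpochParams} {ν : Measure Ξ} [IsProbabilityMeasure ν]

theorem measurable_integral_param {k : ℕ}
    {G : EuclideanSpace ℝ (Fin d) → EuclideanSpace ℝ (Fin n) → Ξ → EuclideanSpace ℝ (Fin k)}
    (hG : Measurable fun q : EuclideanSpace ℝ (Fin d) × EuclideanSpace ℝ (Fin n) × Ξ =>
      G q.1 q.2.1 q.2.2) :
    Measurable fun z : EuclideanSpace ℝ (Fin d) × EuclideanSpace ℝ (Fin n) =>
      ∫ s, G z.1 z.2 s ∂ν := by
  have h : StronglyMeasurable (Function.uncurry
      fun (z : EuclideanSpace ℝ (Fin d) × EuclideanSpace ℝ (Fin n)) (s : Ξ) => G z.1 z.2 s) :=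
    (hG.comp (measurable_fst.fst.prodMk (measurable_fst.snd.prodMk measurable_snd))
      ).stronglyMeasurable
  exact (h.integral_prod_right (ν := ν)).measurable

theorem measurable_stepExponent_param
    (hGxm : Measurable fun q : EuclideanSpace ℝ (Fin d) × EuclideanSpace ℝ (Fin n) × Ξ =>
      Gx q.1 q.2.1 q.2.2)
    (hGym : Measurable fun q : EuclideanSpace ℝ (Fin d) × EuclideanSpace ℝ (Fin n) × Ξ =>
      Gy q.1 q.2.1 q.2.2) (B₁ B₂ R r θ : ℝ) :
    Measurable (Function.uncurry fun (w : (EuclideanSpace ℝ (Fin d) × EuclideanSpace ℝ (Fin n))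
        × (EuclideanSpace ℝ (Fin d) × EuclideanSpace ℝ (Fin n))) (s : Ξ) =>
      stepExponent ν (Gx w.1.1 w.1.2) (fun s' => -Gy w.1.1 w.1.2 s') B₁ B₂ R r θ
        w.2.1 w.2.2 s) := by
  have e : Measurable fun q : ((EuclideanSpace ℝ (Fin d) × EuclideanSpace ℝ (Fin n))
        × (EuclideanSpace ℝ (Fin d) × EuclideanSpace ℝ (Fin n))) × Ξ =>
      (q.1.1.1, q.1.1.2, q.2) :=
    measurable_fst.fst.fst.prodMk (measurable_fst.fst.snd.prodMk measurable_snd)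
  have hx := hGxm.comp e
  have hy := (hGym.comp e).neg
  have hmx := (measurable_integral_param (ν := ν) hGxm).comp
    (measurable_fst.fst : Measurable fun q : ((EuclideanSpace ℝ (Fin d) × EuclideanSpace ℝ (Fin n))
        × (EuclideanSpace ℝ (Fin d) × EuclideanSpace ℝ (Fin n))) × Ξ => q.1.1)
  have hmy := (measurable_integral_param (ν := ν) (G := fun x y s => -Gy x y s) hGym.neg).comp
    (measurable_fst.fst : Measurable fun q : ((EuclideanSpace ℝ (Fin d) × EuclideanSpace ℝ (Fin n))
        × (EuclideanSpace ℝ (Fin d) × EuclideanSpace ℝ (Fin n))) × Ξ => q.1.1)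
  simp only [Function.comp_def] at hx hy hmx hmy
  unfold Function.uncurry stepExponent
  refine ((((((hx.norm.pow_const 2).div_const _).add ((hy.norm.pow_const 2).div_const _)).div_const
    2).sub_const 1).const_mul r).add (((Measurable.const_mul ?_ θ).sub_const _).const_mul (1 - r))
  exact ((hmx.sub hx).inner measurable_fst.snd.fst).add
    ((hmy.sub hy).inner measurable_fst.snd.snd)

theorem measurable_innerIterate_sub_ghostIterate {α : Type*} {mα : MeasurableSpace α}
    (hX : IsClosed X) (hXconv : Convex ℝ X) (hY : IsClosed Y)
    (hYconv : Convex ℝ Y) (hR : 0 < p.R)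
    (hGxm : Measurable fun q : EuclideanSpace ℝ (Fin d) × EuclideanSpace ℝ (Fin n) × Ξ =>
      Gx q.1 q.2.1 q.2.2)
    (hGym : Measurable fun q : EuclideanSpace ℝ (Fin d) × EuclideanSpace ℝ (Fin n) × Ξ =>
      Gy q.1 q.2.1 q.2.2)
    {c₁ : α → EuclideanSpace ℝ (Fin d)} (hc₁ : Measurable c₁) (hc₁X : ∀ a, c₁ a ∈ X)
    {c₂ : α → EuclideanSpace ℝ (Fin n)} (hc₂ : Measurable c₂) (hc₂Y : ∀ a, c₂ a ∈ Y)
    (s : ℕ → α → Ξ) (t : ℕ) (hs : ∀ j < t, Measurable (s j)) :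
    Measurable fun a => (innerIterate X Y Gx Gy p (c₁ a) (c₂ a) (fun j => s j a) t,
      ((innerIterate X Y Gx Gy p (c₁ a) (c₂ a) (fun j => s j a) t).1
        - (ghostIterate ν X Y Gx Gy p (c₁ a) (c₂ a) (fun j => s j a) t).1,
      (innerIterate X Y Gx Gy p (c₁ a) (c₂ a) (fun j => s j a) t).2
        - (ghostIterate ν X Y Gx Gy p (c₁ a) (c₂ a) (fun j => s j a) t).2)) := by
  have hin : ∀ j ≤ t, Measurable fun a =>
      innerIterate X Y Gx Gy p (c₁ a) (c₂ a) (fun j => s j a) j := fun j hj =>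
    measurable_innerIterate hX hXconv hY hYconv hR hGxm hGym hc₁ hc₁X hc₂ hc₂Y s j
      fun i hi => hs i (hi.trans_le hj)
  have hg₁ := measurable_projDescent hX hXconv hR hc₁ hc₁X (p.ηx / 2) (fun j a =>
      (∫ s', Gx (innerIterate X Y Gx Gy p (c₁ a) (c₂ a) (fun j => s j a) j).1
        (innerIterate X Y Gx Gy p (c₁ a) (c₂ a) (fun j => s j a) j).2 s' ∂ν)
      - Gx (innerIterate X Y Gx Gy p (c₁ a) (c₂ a) (fun j => s j a) j).1
        (innerIterate X Y Gx Gy p (c₁ a) (c₂ a) (fun j => s j a) j).2 (s j a)) t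
    fun j hj => ((measurable_integral_param hGxm).comp (hin j hj.le)).sub
      (hGxm.comp ((hin j hj.le).fst.prodMk ((hin j hj.le).snd.prodMk (hs j hj))))
  have hg₂ := measurable_projDescent hY hYconv hR hc₂ hc₂Y (p.ηy / 2) (fun j a =>
      (∫ s', -Gy (innerIterate X Y Gx Gy p (c₁ a) (c₂ a) (fun j => s j a) j).1
        (innerIterate X Y Gx Gy p (c₁ a) (c₂ a) (fun j => s j a) j).2 s' ∂ν)
      - -Gy (innerIterate X Y Gx Gy p (c₁ a) (c₂ a) (fun j => s j a) j).1
        (innerIterate X Y Gx Gy p (c₁ a) (c₂ a) (fun j => s j a) j).2 (s j a)) t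
    fun j hj => ((measurable_integral_param (G := fun x y s => -Gy x y s) hGym.neg).comp
      (hin j hj.le)).sub
      (hGym.neg.comp ((hin j hj.le).fst.prodMk ((hin j hj.le).snd.prodMk (hs j hj))))
  exact (hin t le_rfl).prodMk (((hin t le_rfl).fst.sub hg₁).prodMk ((hin t le_rfl).snd.sub hg₂))

theorem norm_sub_le_two_mul_of_mem_closedBall {c u v : EuclideanSpace ℝ (Fin d)} {R : ℝ}
    (hu : u ∈ Metric.closedBall c R) (hv : v ∈ Metric.closedBall c R) : ‖u - v‖ ≤ 2 * R := by
  rw [← dist_eq_norm]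
  have := dist_triangle_right u v c
  have := Metric.mem_closedBall.1 hu
  have := Metric.mem_closedBall.1 hv
  linarith

theorem SubGaussianNorm.neg {ν : Measure Ξ} {V : Ξ → EuclideanSpace ℝ (Fin d)} {B : ℝ}
    (hV : SubGaussianNorm ν V B) : SubGaussianNorm ν (fun s => -V s) B := by
  simpa only [SubGaussianNorm, norm_neg] using hV

theorem isLogEValue_sum_epochExponent {Ω : Type*} {mΩ : MeasurableSpace Ω}
    {P : Measure Ω} [IsProbabilityMeasure P]
    (hX : IsClosed X) (hXconv : Convex ℝ X) (hY : IsClosed Y)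
    (hYconv : Convex ℝ Y) (hR : 0 < p.R)
    (hGxm : Measurable fun q : EuclideanSpace ℝ (Fin d) × EuclideanSpace ℝ (Fin n) × Ξ =>
      Gx q.1 q.2.1 q.2.2)
    (hGym : Measurable fun q : EuclideanSpace ℝ (Fin d) × EuclideanSpace ℝ (Fin n) × Ξ =>
      Gy q.1 q.2.1 q.2.2)
    {B₁ B₂ : ℝ} (hB₁ : 0 < B₁) (hB₂ : 0 < B₂)
    (hGxB : ∀ x ∈ X, ∀ y ∈ Y, SubGaussianNorm ν (Gx x y) B₁)
    (hGyB : ∀ x ∈ X, ∀ y ∈ Y, SubGaussianNorm ν (Gy x y) B₂)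
    {r : ℝ} (hr0 : 0 ≤ r) (hr1 : r ≤ 1) (θ : ℝ)
    {m : ℕ → MeasurableSpace Ω} (hm : ∀ t, m t ≤ mΩ) (hmono : Monotone m)
    {c₁ : Ω → EuclideanSpace ℝ (Fin d)} (hc₁ : Measurable[m 0] c₁) (hc₁X : ∀ a, c₁ a ∈ X)
    {c₂ : Ω → EuclideanSpace ℝ (Fin n)} (hc₂ : Measurable[m 0] c₂) (hc₂Y : ∀ a, c₂ a ∈ Y)
    {s : ℕ → Ω → Ξ} (hs : ∀ t, Measurable[m (t + 1)] (s t)) (hlaw : ∀ t, P.map (s t) = ν)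
    (hind : ∀ t, Indep (m t) (MeasurableSpace.comap (s t) inferInstance) P) (T : ℕ) :
    IsLogEValue P fun ω => ∑ t ∈ Finset.range T,
      epochExponent ν X Y Gx Gy B₁ B₂ r θ p (c₁ ω) (c₂ ω) (fun j => s j ω) t := by
  -- Iterate and displacement at step `t` use only samples of index below `t`, so they are
  -- predictable.
  have hZ : ∀ t, Measurable[m t] fun a =>
      (innerIterate X Y Gx Gy p (c₁ a) (c₂ a) (fun j => s j a) t,
      ((innerIterate X Y Gx Gy p (c₁ a) (c₂ a) (fun j => s j a) t).1
        - (ghostIterate ν X Y Gx Gy p (c₁ a) (c₂ a) (fun j => s j a) t).1,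
      (innerIterate X Y Gx Gy p (c₁ a) (c₂ a) (fun j => s j a) t).2
        - (ghostIterate ν X Y Gx Gy p (c₁ a) (c₂ a) (fun j => s j a) t).2)) := fun t =>
    measurable_innerIterate_sub_ghostIterate hX hXconv hY hYconv hR hGxm hGym
      (hc₁.mono (hmono t.zero_le) le_rfl) hc₁X (hc₂.mono (hmono t.zero_le) le_rfl) hc₂Y s t
      fun j hj => (hs j).mono (hmono hj) le_rfl
  refine isLogEValue_sum_of_indep hm hmono hs hlaw hind
    (measurable_stepExponent_param (ν := ν) hGxm hGym B₁ B₂ p.R r θ) hZ (fun t ω => ?_) T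
  have hmem := innerIterate_mem (Gx := Gx) (Gy := Gy) hX hY hR.le (hc₁X ω) (hc₂Y ω)
    (fun j => s j ω) t
  have hx₀ : c₁ ω ∈ X ∩ Metric.closedBall (c₁ ω) p.R :=
    ⟨hc₁X ω, Metric.mem_closedBall_self hR.le⟩
  have hy₀ : c₂ ω ∈ Y ∩ Metric.closedBall (c₂ ω) p.R :=
    ⟨hc₂Y ω, Metric.mem_closedBall_self hR.le⟩
  exact isLogEValue_stepExponent (hGxB _ hmem.1.1 _ hmem.2.1)
    (hGyB _ hmem.1.1 _ hmem.2.1).neg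
    (hGxm.comp (measurable_const.prodMk (measurable_const.prodMk measurable_id)))
    (hGym.comp (measurable_const.prodMk (measurable_const.prodMk measurable_id))).neg
    hB₁ hB₂ hR hr0 hr1 θ
    (norm_sub_le_two_mul_of_mem_closedBall hmem.1.2
      (projDescent_mem (hX.inter Metric.isClosed_closedBall) hx₀ t).2)
    (norm_sub_le_two_mul_of_mem_closedBall hmem.2.2
      (projDescent_mem (hY.inter Metric.isClosed_closedBall) hy₀ t).2)

end EpochExponent

/-! ### One epoch halves the gap bound -/

section Epoch

variable {Ξ : Type*} [MeasurableSpace Ξ] {d n : ℕ}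

theorem div_step_mul_le {m R c B η T : ℝ} (hm : 0 < m) (hR : 0 < R) (hc : 0 < c) (hB : 0 < B)
    (hT : 0 < T) (hη : η = m * R ^ 2 / (40 * c * B ^ 2))
    (hN : 3200 * c * B ^ 2 ≤ T * (m ^ 2 * R ^ 2)) : 1 / T * (3 / (2 * η)) ≤ 3 * m / 160 := by
  have e : 1 / T * (3 / (2 * η)) = 60 * c * B ^ 2 / (T * (m * R ^ 2)) := by
    rw [hη]; field_simp; norm_num
  rw [e, div_le_div_iff₀ (by positivity) (by norm_num)]
  nlinarith

theorem half_step_mul_sum {u c B η : ℝ} (hB : 0 < B) (hη : η = u / (40 * c * B ^ 2))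
    {V : ℕ → EuclideanSpace ℝ (Fin d)} {T : ℕ} :
    η / 2 * ∑ t ∈ Finset.range T, (2 * ‖V t‖ ^ 2 + B ^ 2) =
      ∑ t ∈ Finset.range T, u / (40 * c) * (‖V t‖ ^ 2 / B ^ 2)
        + ∑ _t ∈ Finset.range T, u / (40 * c) * (1 / 2) := by
  rw [Finset.mul_sum, ← Finset.sum_add_distrib]
  refine Finset.sum_congr rfl fun t _ => ?_
  have e : η = u / (40 * c) / B ^ 2 := by rw [hη, div_div]
  rw [e]
  field_simp

/-- Deterministic consequence of a small exponent, for the parameters of the algorithm. -/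
theorem sum_variance_add_martingale_le {m R B₁ B₂ L r θ : ℝ} {T : ℕ} (hm : 0 < m) (hR : 0 < R)
    (hB₁ : 0 < B₁) (hB₂ : 0 < B₂) (hL : 0 < L) (hT : 0 < T)
    (hN : 307200 * L * (B₁ + B₂) ^ 2 ≤ T * (m ^ 2 * R ^ 2))
    (hr : r = 2 * L / ((5 + 3 * L) * T)) (hθ : θ = 40 * L / (T * (m * R ^ 2)) / (1 - r))
    (q₁ q₂ D : ℕ → ℝ)
    (hsum : ∑ t ∈ Finset.range T, (r * ((q₁ t + q₂ t) / 2 - 1)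
      + (1 - r) * (θ * D t - θ ^ 2 * (4 * (R * (B₁ + B₂))) ^ 2)) ≤ L) :
    ∑ t ∈ Finset.range T, (m * R ^ 2 / (40 * (5 + 3 * L)) * (q₁ t + 1 / 2 + (q₂ t + 1 / 2)) + D t) ≤
      T * (37 / 800 * (m * R ^ 2)) := by
  have hT' : (0 : ℝ) < T := by exact_mod_cast hT
  have hT1 : (1 : ℝ) ≤ T := by exact_mod_cast hT
  set u := m * R ^ 2 with hu
  have hu0 : 0 < u := by positivity
  set a := u / (40 * (5 + 3 * L)) with ha
  set κ := 40 * L / (T * u) with hκ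
  have hκ0 : 0 < κ := by positivity
  -- `r` and `θ` are tuned so that the weights of the squared norms and of the martingale are `κ *
  -- a` and `κ`. The exponent is then `κ` times the noise in the regret bound, up to the constant `3
  -- * a + θ * σ ^ 2`.
  have hrκ : r = 2 * a * κ := by rw [hr, ha, hκ]; field_simp
  have hr23 : r ≤ 2 / 3 := by
    rw [hr, div_le_div_iff₀ (by positivity) (by norm_num)]
    nlinarith
  have hθκ : (1 - r) * θ = κ := by
    rw [hθ]; field_simp [show 1 - r ≠ 0 by linarith]
  have hθ0 : 0 ≤ θ := by rw [hθ]; exact div_nonneg hκ0.le (by linarith)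
  have hθle : θ ≤ 3 * κ := by nlinarith
  set σ := 4 * (R * (B₁ + B₂)) with hσ
  have hexp : ∀ t, r * ((q₁ t + q₂ t) / 2 - 1) + (1 - r) * (θ * D t - θ ^ 2 * σ ^ 2) =
      κ * ((a * (q₁ t + 1 / 2 + (q₂ t + 1 / 2)) + D t) - (3 * a + θ * σ ^ 2)) := by
    intro t
    calc _ = r * ((q₁ t + q₂ t) / 2 - 1) + (1 - r) * θ * (D t - θ * σ ^ 2) := by ring
      _ = _ := by rw [hθκ, hrκ]; ring
  simp only [hexp, ← Finset.mul_sum] at hsum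
  rw [← le_div_iff₀' hκ0, Finset.sum_sub_distrib, Finset.sum_const, Finset.card_range,
    nsmul_eq_mul] at hsum
  have hLκ : L / κ = T * (u / 40) := by rw [hκ]; field_simp
  have hθσ : θ * σ ^ 2 ≤ u / 160 := by
    have h1 : θ * σ ^ 2 ≤ 3 * κ * σ ^ 2 := by gcongr
    have h2 : 3 * κ * σ ^ 2 = 1920 * (L * (B₁ + B₂) ^ 2 * R ^ 2) / (T * u) := by
      rw [hκ, hσ]; field_simp; norm_num
    have h3 : 1920 * (L * (B₁ + B₂) ^ 2 * R ^ 2) / (T * u) ≤ u / 160 := by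
      rw [div_le_div_iff₀ (by positivity) (by norm_num)]
      have := mul_le_mul_of_nonneg_right hN (sq_nonneg R)
      have e : u * (T * u) = T * (m ^ 2 * R ^ 2) * R ^ 2 := by rw [hu]; ring
      rw [e]
      linarith
    linarith
  have ha3 : 3 * a ≤ 3 / 200 * u := by
    rw [ha, mul_div_assoc', div_le_iff₀ (by positivity)]
    nlinarith
  have hb : T * (3 * a + θ * σ ^ 2) ≤ T * (3 / 200 * u + u / 160) := by gcongr
  rw [hLκ] at hsum
  -- The budget is `1 / 40 + 3 / 200 + 1 / 160 = 37 / 800`: the threshold `L / κ`, the term `3 * a`,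
  -- and the Gaussian compensator.
  linarith

/-- One epoch halves the bound on the duality gap whenever its e-value is at most `exp L`. -/
theorem dualityGap_epochAverage_le {X : Set (EuclideanSpace ℝ (Fin d))}
    {Y : Set (EuclideanSpace ℝ (Fin n))} (hXclosed : IsClosed X) (hYclosed : IsClosed Y)
    (hXconv : Convex ℝ X) (hYconv : Convex ℝ Y)
    {f : EuclideanSpace ℝ (Fin d) → EuclideanSpace ℝ (Fin n) → ℝ}
    (hf : ContinuousOn (fun p : EuclideanSpace ℝ (Fin d) × EuclideanSpace ℝ (Fin n) => f p.1 p.2)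
      (X ×ˢ Y))
    {μ lam m : ℝ} (hm0 : 0 < m) (hmμ : m ≤ μ) (hmlam : m ≤ lam)
    (hfx : ∀ y ∈ Y, StrongConvexOn X μ (fun x => f x y))
    (hfy : ∀ x ∈ X, StrongConcaveOn Y lam (fun y => f x y))
    {ν : Measure Ξ} [IsProbabilityMeasure ν]
    {Gx : EuclideanSpace ℝ (Fin d) → EuclideanSpace ℝ (Fin n) → Ξ → EuclideanSpace ℝ (Fin d)}
    {Gy : EuclideanSpace ℝ (Fin d) → EuclideanSpace ℝ (Fin n) → Ξ → EuclideanSpace ℝ (Fin n)}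
    (hGxm : ∀ x y, Measurable (Gx x y)) (hGym : ∀ x y, Measurable (Gy x y))
    (hGx : ∀ x ∈ X, ∀ y ∈ Y, IsSubgradientOn X (fun x' => f x' y) x (∫ s, Gx x y s ∂ν))
    (hGy : ∀ x ∈ X, ∀ y ∈ Y, IsSupergradientOn Y (fun y' => f x y') y (∫ s, Gy x y s ∂ν))
    {B₁ B₂ : ℝ} (hB₁ : 0 < B₁) (hB₂ : 0 < B₂)
    (hGxB : ∀ x ∈ X, ∀ y ∈ Y, SubGaussianNorm ν (Gx x y) B₁)
    (hGyB : ∀ x ∈ X, ∀ y ∈ Y, SubGaussianNorm ν (Gy x y) B₂)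
    {p : EpochParams} (hR : 0 < p.R) (hT : 0 < p.T) {L r θ : ℝ} (hL : 0 < L)
    (hηx : p.ηx = m * p.R ^ 2 / (40 * (5 + 3 * L) * B₁ ^ 2))
    (hηy : p.ηy = m * p.R ^ 2 / (40 * (5 + 3 * L) * B₂ ^ 2))
    (hN : 307200 * L * (B₁ + B₂) ^ 2 ≤ p.T * (m ^ 2 * p.R ^ 2))
    (hN₁ : 3200 * (5 + 3 * L) * B₁ ^ 2 ≤ p.T * (m ^ 2 * p.R ^ 2))
    (hN₂ : 3200 * (5 + 3 * L) * B₂ ^ 2 ≤ p.T * (m ^ 2 * p.R ^ 2))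
    (hr : r = 2 * L / ((5 + 3 * L) * p.T))
    (hθ : θ = 40 * L / (p.T * (m * p.R ^ 2)) / (1 - r))
    {c₁ : EuclideanSpace ℝ (Fin d)} {c₂ : EuclideanSpace ℝ (Fin n)} (hc₁ : c₁ ∈ X) (hc₂ : c₂ ∈ Y)
    (hgap : dualityGap X Y f c₁ c₂ ≤ m * p.R ^ 2 / 8) {s : ℕ → Ξ}
    (hsum : ∑ t ∈ Finset.range p.T, epochExponent ν X Y Gx Gy B₁ B₂ r θ p c₁ c₂ s t ≤ L) :
    dualityGap X Y f (epochAverage X Y Gx Gy p c₁ c₂ s).1 (epochAverage X Y Gx Gy p c₁ c₂ s).2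
      ≤ m * p.R ^ 2 / 16 := by
  have hT' : (0 : ℝ) < p.T := by exact_mod_cast hT
  have hT1 : (1 : ℝ) ≤ p.T := by exact_mod_cast hT
  have hmin : ∀ y ∈ Y, ∃ a, a ∈ X ∧ IsMinOn (fun x' => f x' y) X a := fun y hy =>
    (hfx y hy).exists_isMinOn (hm0.trans_le hmμ) hXclosed
      (hf.comp (f := fun x' => (x', y)) (by fun_prop) fun x' hx' => ⟨hx', hy⟩) hc₁ (hGx _ hc₁ _ hy)
  have hmax : ∀ x ∈ X, ∃ a, a ∈ Y ∧ IsMaxOn (fun y' => f x y') Y a := fun x hx =>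
    (hfy x hx).exists_isMaxOn (hm0.trans_le hmlam) hYclosed
      (hf.comp (f := fun y' => (x, y')) (by fun_prop) fun y' hy' => ⟨hx, hy'⟩) hc₂ (hGy _ hx _ hc₂)
  have hmem := innerIterate_mem (Gx := Gx) (Gy := Gy) hXclosed hYclosed hR.le hc₁ hc₂ s
  refine dualityGap_le_of_forall_sub_le hXclosed hYclosed hf hm0 hmμ hmlam hfx hfy hmin hmax
    hc₁ hc₂ hR hgap (average_mem hXconv (fun t => (hmem t).1.1) hT)
    (average_mem hYconv (fun t => (hmem t).2.1) hT) le_rfl fun x' hx' y' hy' => ?_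
  set z := innerIterate X Y Gx Gy p c₁ c₂ s with hz
  set g := ghostIterate ν X Y Gx Gy p c₁ c₂ s with hg
  have hηx0 : 0 < p.ηx := by rw [hηx]; positivity
  have hηy0 : 0 < p.ηy := by rw [hηy]; positivity
  set V₁ : ℕ → EuclideanSpace ℝ (Fin d) := fun t => Gx (z t).1 (z t).2 (s t)
  set V₂ : ℕ → EuclideanSpace ℝ (Fin n) := fun t => -Gy (z t).1 (z t).2 (s t)
  set M₁ : ℕ → EuclideanSpace ℝ (Fin d) := fun t => ∫ s', Gx (z t).1 (z t).2 s' ∂ν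
  set M₂ : ℕ → EuclideanSpace ℝ (Fin n) := fun t => ∫ s', -Gy (z t).1 (z t).2 s' ∂ν
  -- The maximizing player is treated as minimizing `-f`.
  have hsub₂ : ∀ t, IsSubgradientOn Y (fun y => -f (z t).1 y) (z t).2 (M₂ t) := fun t w hw => by
    have := hGy _ (hmem t).1.1 _ (hmem t).2.1 w hw
    simp only [M₂, integral_neg, inner_neg_left]
    linarith
  have havg := sub_average_le_of_subgradient (f := f) (xs := fun t => (z t).1)
    (ys := fun t => (z t).2) (g₁ := M₁) (g₂ := M₂)
    (fun y hy => (hfx y hy).convexOn_of_pos (hm0.trans_le hmμ))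
    (fun x hx => (hfy x hx).strongConvexOn_neg.convexOn_of_pos (hm0.trans_le hmlam))
    (fun t => (hmem t).1.1) (fun t => (hmem t).2.1)
    (fun t => hGx _ (hmem t).1.1 _ (hmem t).2.1) hsub₂ hT hx'.1 hy'.1
  have hreg₁ := sum_inner_projDescent_le_of_estimate (hXclosed.inter Metric.isClosed_closedBall)
    (hXconv.inter (convex_closedBall c₁ p.R)) hηx0 V₁ M₁
    (fun t => (hGxB _ (hmem t).1.1 _ (hmem t).2.1).norm_integral_le (hGxm _ _) hB₁) c₁ hx' p.T
  have hreg₂ := sum_inner_projDescent_le_of_estimate (hYclosed.inter Metric.isClosed_closedBall)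
    (hYconv.inter (convex_closedBall c₂ p.R)) hηy0 V₂ M₂
    (fun t => (hGyB _ (hmem t).1.1 _ (hmem t).2.1).neg.norm_integral_le (hGym _ _).neg hB₂)
    c₂ hy' p.T
  have hz₁ : ∀ t, projDescent (X ∩ Metric.closedBall c₁ p.R) p.ηx V₁ c₁ t = (z t).1 := fun t =>
    (congrArg Prod.fst (innerIterate_eq_projDescent c₁ c₂ s t)).symm
  have hz₂ : ∀ t, projDescent (Y ∩ Metric.closedBall c₂ p.R) p.ηy V₂ c₂ t = (z t).2 := fun t =>
    (congrArg Prod.snd (innerIterate_eq_projDescent c₁ c₂ s t)).symm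
  have hg₁ : ∀ t, projDescent (X ∩ Metric.closedBall c₁ p.R) (p.ηx / 2) (fun t => M₁ t - V₁ t) c₁ t
      = (g t).1 := fun t => rfl
  have hg₂ : ∀ t, projDescent (Y ∩ Metric.closedBall c₂ p.R) (p.ηy / 2) (fun t => M₂ t - V₂ t) c₂ t
      = (g t).2 := fun t => rfl
  simp only [hz₁, hg₁] at hreg₁
  simp only [hz₂, hg₂] at hreg₂
  have hs₁ := mul_le_mul_of_nonneg_right
    (div_step_mul_le hm0 hR (by positivity) hB₁ hT' hηx hN₁) (sq_nonneg ‖x' - c₁‖)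
  have hs₂ := mul_le_mul_of_nonneg_right
    (div_step_mul_le hm0 hR (by positivity) hB₂ hT' hηy hN₂) (sq_nonneg ‖y' - c₂‖)
  have hnum := sum_variance_add_martingale_le hm0 hR hB₁ hB₂ hL hT hN hr hθ
    (fun t => ‖V₁ t‖ ^ 2 / B₁ ^ 2) (fun t => ‖V₂ t‖ ^ 2 / B₂ ^ 2)
    (fun t => inner ℝ (M₁ t - V₁ t) ((z t).1 - (g t).1)
      + inner ℝ (M₂ t - V₂ t) ((z t).2 - (g t).2)) hsum
  rw [half_step_mul_sum hB₁ hηx] at hreg₁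
  rw [half_step_mul_sum hB₂ hηy] at hreg₂
  generalize m * p.R ^ 2 / (40 * (5 + 3 * L)) = a at hnum hreg₁ hreg₂
  simp only [mul_add, Finset.sum_add_distrib] at hnum
  have htot : ∑ t ∈ Finset.range p.T, inner ℝ (M₁ t) ((z t).1 - x')
      + ∑ t ∈ Finset.range p.T, inner ℝ (M₂ t) ((z t).2 - y') ≤
      3 / (2 * p.ηx) * ‖x' - c₁‖ ^ 2 + 3 / (2 * p.ηy) * ‖y' - c₂‖ ^ 2
        + p.T * (37 / 800 * (m * p.R ^ 2)) := by
    linarith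
  have hfin := mul_le_mul_of_nonneg_left htot (by positivity : 0 ≤ 1 / (p.T : ℝ))
  have e : 1 / (p.T : ℝ) * (p.T * (37 / 800 * (m * p.R ^ 2))) = 37 / 800 * (m * p.R ^ 2) := by
    field_simp
  refine havg.trans (hfin.trans ?_)
  rw [mul_add, mul_add, e]
  linarith

end Epoch

/-! ### Markov's inequality and the union bound -/

section Probability

theorem IsLogEValue.measureReal_lt_le {Ω : Type*} [MeasurableSpace Ω] {P : Measure Ω}
    {A : Ω → ℝ} (hA : IsLogEValue P A) (L : ℝ) :
    P.real {ω | L < A ω} ≤ Real.exp (-L) := by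
  refine ENNReal.toReal_le_of_le_ofReal (Real.exp_pos _).le ?_
  have hpos : ENNReal.ofReal (Real.exp L) ≠ 0 := by simp [Real.exp_pos]
  calc P {ω | L < A ω}
      ≤ P {ω | ENNReal.ofReal (Real.exp L) ≤ ENNReal.ofReal (Real.exp (A ω))} :=
        measure_mono fun ω hω => ENNReal.ofReal_le_ofReal (Real.exp_le_exp.2 (le_of_lt hω))
    _ ≤ (∫⁻ ω, ENNReal.ofReal (Real.exp (A ω)) ∂P) / ENNReal.ofReal (Real.exp L) :=
        meas_ge_le_lintegral_div
          (ENNReal.measurable_ofReal.comp hA.1.exp).aemeasurable hpos ENNReal.ofReal_ne_top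
    _ ≤ 1 / ENNReal.ofReal (Real.exp L) := by gcongr; exact hA.2
    _ = ENNReal.ofReal (Real.exp (-L)) := by
        rw [Real.exp_neg, ENNReal.ofReal_inv_of_pos (Real.exp_pos L), one_div]

/-- Union bound over finitely many log-e-values. -/
theorem one_sub_le_measureReal_forall_le {Ω : Type*} [MeasurableSpace Ω] {P : Measure Ω}
    [IsProbabilityMeasure P] {A : ℕ → Ω → ℝ} (hA : ∀ k, IsLogEValue P (A k)) (L : ℝ) (K : ℕ) :
    1 - K * Real.exp (-L) ≤ P.real {ω | ∀ k < K, A k ω ≤ L} := by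
  have hmeas : MeasurableSet {ω | ∀ k < K, A k ω ≤ L} := by
    have : {ω | ∀ k < K, A k ω ≤ L} = ⋂ k, ⋂ _ : k < K, {ω | A k ω ≤ L} := by ext; simp
    rw [this]
    exact MeasurableSet.iInter fun k => MeasurableSet.iInter fun _ =>
      measurableSet_le (hA k).1 measurable_const
  have hcompl : P.real {ω | ∀ k < K, A k ω ≤ L}ᶜ ≤ K * Real.exp (-L) := by
    have : {ω | ∀ k < K, A k ω ≤ L}ᶜ ⊆ ⋃ k ∈ Finset.range K, {ω | L < A k ω} := by
      intro ω hω
      simpa using hω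
    calc _ ≤ P.real (⋃ k ∈ Finset.range K, {ω | L < A k ω}) := measureReal_mono this (measure_ne_top _ _)
      _ ≤ ∑ k ∈ Finset.range K, P.real {ω | L < A k ω} := measureReal_biUnion_finset_le _ _
      _ ≤ ∑ _k ∈ Finset.range K, Real.exp (-L) :=
          Finset.sum_le_sum fun k _ => (hA k).measureReal_lt_le L
      _ = K * Real.exp (-L) := by simp
  rw [measureReal_compl hmeas, probReal_univ] at hcompl
  linarith

end Probability

/-! ### The filtration generated by the samples -/

section Past

variable {Ω Ξ : Type*} [mΞ : MeasurableSpace Ξ]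

/-- The information carried by the samples drawn before step `t` of epoch `k + 1`. -/
@[reducible] def pastSamples (ξ : ℕ → ℕ → Ω → Ξ) (k t : ℕ) : MeasurableSpace Ω :=
  ⨆ i ∈ {i : ℕ × ℕ | i.1 < k ∨ i.1 = k ∧ i.2 < t}, mΞ.comap (ξ i.1 i.2)

theorem pastSamples_le [mΩ : MeasurableSpace Ω] {ξ : ℕ → ℕ → Ω → Ξ}
    (hξ : ∀ k t, Measurable (ξ k t)) (k t : ℕ) : pastSamples ξ k t ≤ mΩ :=
  iSup₂_le fun i _ => (hξ i.1 i.2).comap_le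

theorem pastSamples_mono (ξ : ℕ → ℕ → Ω → Ξ) (k : ℕ) : Monotone (pastSamples ξ k) :=
  fun _ _ h => biSup_mono fun _ hi => hi.imp_right fun hi => ⟨hi.1, hi.2.trans_le h⟩

theorem measurable_pastSamples (ξ : ℕ → ℕ → Ω → Ξ) {k t i j : ℕ}
    (h : i < k ∨ i = k ∧ j < t) : Measurable[pastSamples ξ k t] (ξ i j) :=
  measurable_iff_comap_le.2
    (le_iSup₂_of_le (f := fun (i : ℕ × ℕ) (_ : i ∈ {i : ℕ × ℕ | i.1 < k ∨ i.1 = k ∧ i.2 < t}) =>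
      mΞ.comap (ξ i.1 i.2)) (i, j) h le_rfl)

theorem indep_pastSamples [MeasurableSpace Ω] {P : Measure Ω} {ξ : ℕ → ℕ → Ω → Ξ}
    (hξ : ∀ k t, Measurable (ξ k t)) (hind : iIndepFun (fun i : ℕ × ℕ => ξ i.1 i.2) P) (k t : ℕ) :
    Indep (pastSamples ξ k t) (MeasurableSpace.comap (ξ k t) mΞ) P := by
  have h := indep_iSup_of_disjoint (fun i : ℕ × ℕ => (hξ i.1 i.2).comap_le) hind.iIndep
    (S := {i : ℕ × ℕ | i.1 < k ∨ i.1 = k ∧ i.2 < t}) (T := {(k, t)})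
    (Set.disjoint_singleton_right.2 (by simp))
  rwa [iSup_singleton] at h

end Past

/-! ### Counting iterations -/

section Iterations

theorem totalIterations_eq (p : EpochParams) (K : ℕ) :
    (totalIterations p K : ℝ) = (2 ^ K - 1) * p.T := by
  induction K with
  | zero => simp [totalIterations]
  | succ K ih =>
    rw [totalIterations, Finset.sum_range_succ, Nat.cast_add, ← totalIterations, ih,
      epochParams_T]
    push_cast
    ring

theorem two_pow_ceil_logb_bounds {q : ℝ} (hq : 1 < q) :
    q ≤ 2 ^ ⌈Real.logb 2 q⌉₊ ∧ (2 : ℝ) ^ ⌈Real.logb 2 q⌉₊ ≤ 2 * q := by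
  have hq0 : 0 < q := by linarith
  have hlog : 0 < Real.logb 2 q := Real.logb_pos (by norm_num) hq
  constructor
  · rw [← Real.rpow_natCast, ← Real.logb_le_iff_le_rpow (by norm_num) hq0]
    exact Nat.le_ceil _
  · have h := (Nat.ceil_lt_add_one hlog.le).le
    calc (2 : ℝ) ^ ⌈Real.logb 2 q⌉₊ = (2 : ℝ) ^ ((⌈Real.logb 2 q⌉₊ : ℕ) : ℝ) :=
          (Real.rpow_natCast _ _).symm
      _ ≤ 2 ^ (Real.logb 2 q + 1) := Real.rpow_le_rpow_of_exponent_le (by norm_num) h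
      _ = 2 * q := by
          rw [Real.rpow_add (by norm_num), Real.rpow_logb (by norm_num) (by norm_num) hq0,
            Real.rpow_one, mul_comm]

theorem epochConst_le {B₁ B₂ δ' : ℝ} (hB₁ : 0 < B₁) (hB₂ : 0 < B₂)
    (hL : 0 < Real.log (1 / δ')) :
    epochConst B₁ B₂ δ' ≤ (16000 + 307200 * Real.log (1 / δ')) * (B₁ + B₂) ^ 2 := by
  have h1 : B₁ ^ 2 ≤ (B₁ + B₂) ^ 2 := by gcongr; linarith
  have h2 : B₂ ^ 2 ≤ (B₁ + B₂) ^ 2 := by gcongr; linarith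
  refine max_le ?_ ?_
  · nlinarith [sq_nonneg (B₁ + B₂)]
  · calc 3200 * (5 + 3 * Real.log (1 / δ')) * max (B₁ ^ 2) (B₂ ^ 2)
        ≤ 3200 * (5 + 3 * Real.log (1 / δ')) * (B₁ + B₂) ^ 2 := by gcongr; exact max_le h1 h2
      _ ≤ _ := by gcongr; linarith

end Iterations

/-! ### Invariance of `T * R ^ 2` across epochs -/

section Scaling

variable {p : EpochParams}

theorem epochParams_R_sq (k : ℕ) : (epochParams p k).R ^ 2 = p.R ^ 2 / 2 ^ k := by
  rw [epochParams_R, div_pow, ← pow_mul, mul_comm k, pow_mul, Real.sq_sqrt (by norm_num)]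

/-- The length and noise conditions involve `T` and `R` only through this product, so checking them
for the first epoch suffices. -/
theorem epochParams_T_mul_R_sq (c : ℝ) (k : ℕ) :
    ((epochParams p k).T : ℝ) * (c * (epochParams p k).R ^ 2) = p.T * (c * p.R ^ 2) := by
  rw [epochParams_R_sq, epochParams_T]
  push_cast
  field_simp

end Scaling

/-! ### The main theorem -/

theorem theorem1 {d n : ℕ}
    -- the min-max problem
    (X : Set (EuclideanSpace ℝ (Fin d))) (Y : Set (EuclideanSpace ℝ (Fin n)))
    (hXclosed : IsClosed X) (hXconv : Convex ℝ X)
    (hYclosed : IsClosed Y) (hYconv : Convex ℝ Y)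
    (f : EuclideanSpace ℝ (Fin d) → EuclideanSpace ℝ (Fin n) → ℝ)
    (hf : ContinuousOn (fun p : EuclideanSpace ℝ (Fin d) × EuclideanSpace ℝ (Fin n) => f p.1 p.2)
      (X ×ˢ Y))
    (μ lam : ℝ) (hμ : 0 < μ) (hlam : 0 < lam)
    (hfx : ∀ y ∈ Y, StrongConvexOn X μ (fun x => f x y))
    (hfy : ∀ x ∈ X, StrongConcaveOn Y lam (fun y => f x y))
    -- the initial point
    (x₀ : EuclideanSpace ℝ (Fin d)) (y₀ : EuclideanSpace ℝ (Fin n)) (hx₀ : x₀ ∈ X) (hy₀ : y₀ ∈ Y)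
    (ε₀ : ℝ) (hε₀ : 0 < ε₀) (hgap : dualityGap X Y f x₀ y₀ ≤ ε₀)
    -- stochastic subgradients, `ν` being the law of a sample
    {Ξ : Type*} [MeasurableSpace Ξ] (ν : Measure Ξ) [IsProbabilityMeasure ν]
    (Gx : EuclideanSpace ℝ (Fin d) → EuclideanSpace ℝ (Fin n) → Ξ → EuclideanSpace ℝ (Fin d))
    (Gy : EuclideanSpace ℝ (Fin d) → EuclideanSpace ℝ (Fin n) → Ξ → EuclideanSpace ℝ (Fin n))
    (hGxm : Measurable fun q : EuclideanSpace ℝ (Fin d) × EuclideanSpace ℝ (Fin n) × Ξ =>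
      Gx q.1 q.2.1 q.2.2)
    (hGym : Measurable fun q : EuclideanSpace ℝ (Fin d) × EuclideanSpace ℝ (Fin n) × Ξ =>
      Gy q.1 q.2.1 q.2.2)
    (hGx : ∀ x ∈ X, ∀ y ∈ Y, IsSubgradientOn X (fun x' => f x' y) x (∫ s, Gx x y s ∂ν))
    (hGy : ∀ x ∈ X, ∀ y ∈ Y, IsSupergradientOn Y (fun y' => f x y') y (∫ s, Gy x y s ∂ν))
    (B₁ B₂ : ℝ) (hB₁ : 0 < B₁) (hB₂ : 0 < B₂)
    (hGxB : ∀ x ∈ X, ∀ y ∈ Y, SubGaussianNorm ν (Gx x y) B₁)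
    (hGyB : ∀ x ∈ X, ∀ y ∈ Y, SubGaussianNorm ν (Gy x y) B₂)
    -- independent samples: `ξ k t` is used at step `t` of epoch `k + 1`
    {Ω : Type*} [MeasurableSpace Ω] (P : Measure Ω) [IsProbabilityMeasure P]
    (ξ : ℕ → ℕ → Ω → Ξ) (hξm : ∀ k t, Measurable (ξ k t))
    (hξlaw : ∀ k t, P.map (ξ k t) = ν)
    (hξindep : iIndepFun (fun i : ℕ × ℕ => ξ i.1 i.2) P)
    -- failure probability, accuracy, number of epochs and initial parameters
    (δ ε : ℝ) (hδ0 : 0 < δ) (hδ1 : δ < 1) (hε0 : 0 < ε) (hε1 : ε < 1) (hε : ε < ε₀)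
    (K : ℕ) (hK : K = ⌈Real.logb 2 (ε₀ / ε)⌉₊)
    (δ' : ℝ) (hδ' : δ' = δ / K)
    (m : ℝ) (hm : m = min μ lam)
    (p : EpochParams)
    (hR : 2 * Real.sqrt (2 * ε₀ / m) ≤ p.R)
    (hηx : p.ηx = m * p.R ^ 2 / (40 * (5 + 3 * Real.log (1 / δ')) * B₁ ^ 2))
    (hηy : p.ηy = m * p.R ^ 2 / (40 * (5 + 3 * Real.log (1 / δ')) * B₂ ^ 2))
    (hT : epochConst B₁ B₂ δ' / (m ^ 2 * p.R ^ 2) ≤ (p.T : ℝ)) :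
    -- accuracy reached after `K` epochs
    (1 - δ ≤ P.real {ω |
        dualityGap X Y f (epochGDA X Y Gx Gy p x₀ y₀ (fun k t => ξ k t ω) K).1
          (epochGDA X Y Gx Gy p x₀ y₀ (fun k t => ξ k t ω) K).2
          ≤ m * p.R ^ 2 / (8 * ε₀) * ε}) ∧
    (p.R = 2 * Real.sqrt (2 * ε₀ / m) →
      1 - δ ≤ P.real {ω |
        dualityGap X Y f (epochGDA X Y Gx Gy p x₀ y₀ (fun k t => ξ k t ω) K).1
          (epochGDA X Y Gx Gy p x₀ y₀ (fun k t => ξ k t ω) K).2 ≤ ε}) ∧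
    -- total number of iterations
    ((totalIterations p K : ℝ) ≤ epochConst B₁ B₂ δ' / (4 * m * ε)
        + ((p.T : ℝ) - epochConst B₁ B₂ δ' / (m ^ 2 * p.R ^ 2)) * (2 * ε₀ / ε)) ∧
    (p.T = ⌈epochConst B₁ B₂ δ' / (m ^ 2 * p.R ^ 2)⌉₊ →
      (totalIterations p K : ℝ) ≤ epochConst B₁ B₂ δ' / (4 * m * ε) + 2 * ε₀ / ε) ∧
    (p.T = ⌈epochConst B₁ B₂ δ' / (m ^ 2 * p.R ^ 2)⌉₊ → ε₀ ≤ (B₁ + B₂) ^ 2 / m →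
      (totalIterations p K : ℝ) ≤ 10 ^ 5 * (1 + Real.log (K / δ)) * (B₁ + B₂) ^ 2 / (m * ε)) := by
  have hm0 : 0 < m := hm ▸ lt_min hμ hlam
  have hmμ : m ≤ μ := hm ▸ min_le_left _ _
  have hmlam : m ≤ lam := hm ▸ min_le_right _ _
  have hq : 1 < ε₀ / ε := (one_lt_div hε0).2 hε
  obtain ⟨hK₁, hK₂⟩ := two_pow_ceil_logb_bounds hq
  rw [← hK] at hK₁ hK₂
  have hK0 : 0 < K := hK ▸ Nat.ceil_pos.2 (Real.logb_pos (by norm_num) hq)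
  have hK1 : (1 : ℝ) ≤ K := by exact_mod_cast hK0
  have hδ'0 : 0 < δ' := by rw [hδ']; positivity
  have hδ'1 : δ' < 1 := by rw [hδ', div_lt_one (by positivity)]; linarith
  set L := Real.log (1 / δ') with hLdef
  have hL : 0 < L := Real.log_pos ((one_lt_div hδ'0).2 hδ'1)
  have hLK : L = Real.log (K / δ) := by rw [hLdef, hδ', one_div_div]
  have hexpL : K * Real.exp (-L) = δ := by
    rw [hLdef, one_div, Real.log_inv, neg_neg, Real.exp_log hδ'0, hδ']
    field_simp
  have hRpos : 0 < p.R := lt_of_lt_of_le (by positivity) hR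
  have hu8 : 8 * ε₀ ≤ m * p.R ^ 2 := by
    have h1 : (2 * √(2 * ε₀ / m)) ^ 2 ≤ p.R ^ 2 := by gcongr
    rw [mul_pow, Real.sq_sqrt (by positivity)] at h1
    calc 8 * ε₀ = m * (2 ^ 2 * (2 * ε₀ / m)) := by field_simp; norm_num
      _ ≤ m * p.R ^ 2 := by gcongr
  have hC0 : 0 < epochConst B₁ B₂ δ' := lt_max_of_lt_left (by positivity)
  have hTpos : 0 < p.T := by
    have : (0 : ℝ) < p.T := lt_of_lt_of_le (by positivity) hT
    exact_mod_cast this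
  have hCT : epochConst B₁ B₂ δ' ≤ p.T * (m ^ 2 * p.R ^ 2) :=
    (div_le_iff₀ (by positivity)).1 hT
  have hN : 307200 * L * (B₁ + B₂) ^ 2 ≤ p.T * (m ^ 2 * p.R ^ 2) := by
    refine le_trans (le_of_eq ?_) ((le_max_left _ _).trans hCT)
    ring
  have hNmax : 3200 * (5 + 3 * L) * max (B₁ ^ 2) (B₂ ^ 2) ≤ p.T * (m ^ 2 * p.R ^ 2) :=
    (le_max_right _ _).trans hCT
  have hN₁ : 3200 * (5 + 3 * L) * B₁ ^ 2 ≤ p.T * (m ^ 2 * p.R ^ 2) := by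
    refine le_trans ?_ hNmax
    gcongr
    exact le_max_left _ _
  have hN₂ : 3200 * (5 + 3 * L) * B₂ ^ 2 ≤ p.T * (m ^ 2 * p.R ^ 2) := by
    refine le_trans ?_ hNmax
    gcongr
    exact le_max_right _ _
  have hRk : ∀ k, 0 < (epochParams p k).R := fun k => by rw [epochParams_R]; positivity
  have hTk : ∀ k, 0 < (epochParams p k).T := fun k => by rw [epochParams_T]; positivity
  set r : ℕ → ℝ := fun k => 2 * L / ((5 + 3 * L) * (epochParams p k).T) with hr
  set θ : ℕ → ℝ := fun k =>
    40 * L / ((epochParams p k).T * (m * (epochParams p k).R ^ 2)) / (1 - r k) with hθ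
  have hr0 : ∀ k, 0 ≤ r k := fun k => by rw [hr]; positivity
  have hr1 : ∀ k, r k ≤ 1 := fun k => by
    have h1 : (1 : ℝ) ≤ (epochParams p k).T := by exact_mod_cast hTk k
    rw [hr, div_le_one (by positivity)]
    nlinarith
  set z : ℕ → Ω → EuclideanSpace ℝ (Fin d) × EuclideanSpace ℝ (Fin n) := fun k ω =>
    epochGDA X Y Gx Gy p x₀ y₀ (fun k t => ξ k t ω) k with hz
  have hzmem : ∀ k ω, (z k ω).1 ∈ X ∧ (z k ω).2 ∈ Y := fun k ω =>
    epochGDA_mem hXclosed hXconv hYclosed hYconv hRpos hTpos hx₀ hy₀ (fun k t => ξ k t ω) k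
  have hzmeas : ∀ k, Measurable[pastSamples ξ k 0] (z k) := fun k =>
    measurable_epochGDA hXclosed hXconv hYclosed hYconv hRpos hTpos hGxm hGym hx₀ hy₀ ξ k
      fun i hi j => measurable_pastSamples ξ (Or.inl hi)
  set A : ℕ → Ω → ℝ := fun k ω => ∑ t ∈ Finset.range (epochParams p k).T,
    epochExponent ν X Y Gx Gy B₁ B₂ (r k) (θ k) (epochParams p k) (z k ω).1 (z k ω).2
      (fun t => ξ k t ω) t with hA
  -- This holds whether or not earlier epochs succeeded: only membership of the random centre in `X
  -- × Y` is used. The union bound therefore needs no conditioning.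
  have hAe : ∀ k, IsLogEValue P (A k) := fun k =>
    isLogEValue_sum_epochExponent hXclosed hXconv hYclosed hYconv (hRk k) hGxm hGym hB₁ hB₂
      hGxB hGyB (hr0 k) (hr1 k) (θ k) (pastSamples_le hξm k) (pastSamples_mono ξ k)
      (measurable_fst.comp (hzmeas k)) (fun ω => (hzmem k ω).1)
      (measurable_snd.comp (hzmeas k)) (fun ω => (hzmem k ω).2)
      (fun t => measurable_pastSamples ξ (Or.inr ⟨rfl, t.lt_succ_self⟩)) (hξlaw k)
      (indep_pastSamples hξm hξindep k) _
  -- On the good event everything is deterministic. The base case is `8 * ε₀ ≤ m * R ^ 2`, the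
  -- reason for the lower bound on the initial radius.
  have hinv : ∀ ω, (∀ k < K, A k ω ≤ L) → ∀ k ≤ K,
      dualityGap X Y f (z k ω).1 (z k ω).2 ≤ m * (epochParams p k).R ^ 2 / 8 := by
    intro ω hω k
    induction k with
    | zero =>
      intro _
      have : dualityGap X Y f x₀ y₀ ≤ m * p.R ^ 2 / 8 := by linarith
      exact this
    | succ k ih =>
      intro hk
      have hstep := dualityGap_epochAverage_le hXclosed hYclosed hXconv hYconv hf hm0 hmμ hmlam
        hfx hfy
        (fun x y => hGxm.comp (measurable_const.prodMk (measurable_const.prodMk measurable_id)))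
        (fun x y => hGym.comp (measurable_const.prodMk (measurable_const.prodMk measurable_id)))
        hGx hGy hB₁ hB₂ hGxB hGyB (hRk k) (hTk k) hL
        (by rw [epochParams_ηx, hηx, epochParams_R_sq]; ring)
        (by rw [epochParams_ηy, hηy, epochParams_R_sq]; ring)
        (by rwa [epochParams_T_mul_R_sq]) (by rwa [epochParams_T_mul_R_sq])
        (by rwa [epochParams_T_mul_R_sq]) (r := r k) (θ := θ k) rfl rfl
        (hzmem k ω).1 (hzmem k ω).2 (ih (Nat.le_of_succ_le hk)) (hω k hk)
      refine hstep.trans_eq ?_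
      rw [epochParams_R_sq, epochParams_R_sq, pow_succ]
      ring
  have hfinal : ∀ ω, (∀ k < K, A k ω ≤ L) →
      dualityGap X Y f (z K ω).1 (z K ω).2 ≤ m * p.R ^ 2 / (8 * ε₀) * ε := by
    intro ω hω
    refine (hinv ω hω K le_rfl).trans ?_
    rw [epochParams_R_sq]
    have : p.R ^ 2 / 2 ^ K ≤ p.R ^ 2 / (ε₀ / ε) := by gcongr
    calc m * (p.R ^ 2 / 2 ^ K) / 8 ≤ m * (p.R ^ 2 / (ε₀ / ε)) / 8 := by gcongr
      _ = _ := by field_simp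
  have hprob : 1 - δ ≤ P.real {ω | dualityGap X Y f (z K ω).1 (z K ω).2
      ≤ m * p.R ^ 2 / (8 * ε₀) * ε} := by
    rw [← hexpL]
    exact (one_sub_le_measureReal_forall_le hAe L K).trans
      (measureReal_mono hfinal (measure_ne_top _ _))
  have hq0 : 0 < ε₀ / ε := by positivity
  set a := epochConst B₁ B₂ δ' / (m ^ 2 * p.R ^ 2) with ha
  have ha0 : 0 ≤ a := by positivity
  have haε : a * (2 * ε₀ / ε) ≤ epochConst B₁ B₂ δ' / (4 * m * ε) := by
    have h1 : a ≤ epochConst B₁ B₂ δ' / (m * (8 * ε₀)) := by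
      rw [ha]
      refine div_le_div_of_nonneg_left hC0.le (by positivity) ?_
      calc m * (8 * ε₀) ≤ m * (m * p.R ^ 2) := by gcongr
        _ = m ^ 2 * p.R ^ 2 := by ring
    calc a * (2 * ε₀ / ε) ≤ epochConst B₁ B₂ δ' / (m * (8 * ε₀)) * (2 * ε₀ / ε) := by gcongr
      _ = _ := by field_simp; norm_num
  have htot : (totalIterations p K : ℝ) ≤ epochConst B₁ B₂ δ' / (4 * m * ε)
      + ((p.T : ℝ) - a) * (2 * ε₀ / ε) := by
    rw [totalIterations_eq]
    have h1 : ((2 : ℝ) ^ K - 1) * p.T ≤ (2 * ε₀ / ε) * p.T := by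
      have : (2 : ℝ) ^ K - 1 ≤ 2 * ε₀ / ε := by rw [mul_div_assoc]; linarith
      gcongr
    linarith
  have htot' : p.T = ⌈a⌉₊ →
      (totalIterations p K : ℝ) ≤ epochConst B₁ B₂ δ' / (4 * m * ε) + 2 * ε₀ / ε := by
    intro hTa
    have h1 : (p.T : ℝ) - a ≤ 1 := by
      rw [hTa]
      linarith [Nat.ceil_lt_add_one ha0]
    have h2 : ((p.T : ℝ) - a) * (2 * ε₀ / ε) ≤ 1 * (2 * ε₀ / ε) := by gcongr
    linarith
  refine ⟨hprob, fun hReq => ?_, htot, htot', fun hTa hεB => (htot' hTa).trans ?_⟩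
  · have : m * p.R ^ 2 / (8 * ε₀) * ε = ε := by
      rw [hReq, mul_pow, Real.sq_sqrt (by positivity)]
      field_simp
      norm_num
    rwa [this] at hprob
  · rw [← hLK]
    have h1 : 2 * ε₀ / ε ≤ 2 * ((B₁ + B₂) ^ 2 / m) / ε := by gcongr
    have h2 : epochConst B₁ B₂ δ' / (4 * m * ε) ≤
        (16000 + 307200 * L) * (B₁ + B₂) ^ 2 / (4 * m * ε) := by
      gcongr
      exact epochConst_le hB₁ hB₂ hL
    -- Here `4002 = 16000 / 4 + 2` and `76800 = 307200 / 4`, where `307200 = 3 * 320 ^ 2`; the `2`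
    -- pays for rounding up the first epoch length.
    have h3 : (16000 + 307200 * L) * (B₁ + B₂) ^ 2 / (4 * m * ε) + 2 * ((B₁ + B₂) ^ 2 / m) / ε =
        (4002 + 76800 * L) * ((B₁ + B₂) ^ 2 / (m * ε)) := by
      field_simp
      ring
    calc _ ≤ (4002 + 76800 * L) * ((B₁ + B₂) ^ 2 / (m * ε)) := by linarith
      _ ≤ 10 ^ 5 * (1 + L) * ((B₁ + B₂) ^ 2 / (m * ε)) := by
          gcongr
          linarith
      _ = _ := by ring
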